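/- Let $\mathcal M=\langle\mathbb R,<,+,0,1\rangle$; "definable" means first-order definable in $\mathcal M$ without parameters. A \emph{timed game} consists of $n\in\mathbb N$ clocks, finite sets of locations $Q$ and of actions $\Sigma=\Sigma_c\sqcup\Sigma_u$ (controllable and uncontrollable), goal locations $\mathrm{Goal}\subseteq Q$, and finitely many transitions $(q,g,a,\rho,q')$, where the guard $g$ is a Boolean combination of constraints $x_i\le c$, $c\le x_i$ with $c\in\mathbb Q_{\ge 0}$, and $\rho$ is a set of clocks that are reset to $0$ (the others are unchanged). It is a game over the dynamics $\gamma_q(x,t)=(x_1+t,\dots,x_n+t)$, $x\in\mathbb R_{\ge0}^n$, $t\ge 0$, with states $(q,y)\in Q\times\mathbb R_{\ge0}^n$. Write $(q,x,t,y)\xrightarrow{\tau,a}(q',x',t',y')$, where $y=\gamma_q(x,t)$ and $y'=\gamma_{q'}(x',t')$, if $\tau\ge 0$ and some transition $(q,g,a,\rho,q')$ has $\gamma_q(x,t+\tau)\in g$ and $y'=\gamma_q(x,t+\tau)$ with the clocks of $\rho$ set to $0$. Runs are finite or infinite sequences of such steps. A strategy (under perfect observation) is a partial function $\lambda$ from finite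 runs to $\mathbb R_{\ge0}\times\Sigma_c$ such that $\lambda(\varrho)$, where defined, is enabled in the last configuration of $\varrho$. A run is consistent with $\lambda$ if, whenever $\lambda$ has the value $(\tau,a)$ on a prefix of it, the next step $(\tau',a')$ of the run, if there is one, satisfies $(\tau',a')=(\tau,a)$, or $\tau'\le\tau$ and $a'\in\Sigma_u$. A consistent run is maximal if it is infinite, or finite with $\lambda$ undefined on it. The state $(q,y)$ is \emph{winning} if there is a strategy $\lambda$ such that, for all $(x,t)$ with $\gamma_q(x,t)=y$, every maximal consistent run from $(q,x,t,y)$ visits a location of $\mathrm{Goal}$. Then: (1) (The control problem under perfect observation is decidable.) There is an algorithm that, given a timed game, a location $q$, and a first-order formula of the language $\{<,+,0,1\}$ that defines a point $y\in\mathbb R_{\ge0}^n$, decides whether $(q,y)$ is winning. (2) (The set of winning states is computable.) There is an algorithm that, given a timed game and a location $q$, outputs a first-order formula of the language $\{<,+,0,1\}$ that defines $\{y\in\mathbb R_{\ge0}^n : (q,y)\text{ is winning}\}$ in $\mathcal M$. -/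

import Mathlib

/-! ## The structure `⟨ℝ, <, +, 0, 1⟩` and codes of its first-order formulas -/

/-- Function symbols of the language `<, +, 0, 1`. -/
inductive LinFunc : ℕ → Type
  | zero : LinFunc 0
  | one : LinFunc 0
  | add : LinFunc 2

/-- Relation symbols of the language `<, +, 0, 1`. -/
inductive LinRel : ℕ → Type
  | lt : LinRel 2

/-- The first-order language with symbols `<, +, 0, 1`. -/
abbrev linLang : FirstOrder.Language.{0, 0} where
  Functions := LinFunc
  Relations := LinRel

/-- The structure `⟨ℝ, <, +, 0, 1⟩`. -/
noncomputable instance linLangStructureReal : linLang.Structure ℝ where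
  funMap := @fun
    | _, LinFunc.zero, _ => 0
    | _, LinFunc.one, _ => 1
    | _, LinFunc.add, v => v 0 + v 1
  RelMap := @fun
    | _, LinRel.lt, v => v 0 < v 1

/-- Gödel number of a term with free variables `y₀, …, y_{n-1}` and bound variables
`z₀, …, z_{k-1}`. -/
def termCode {n k : ℕ} : linLang.Term (Fin n ⊕ Fin k) → ℕ
  | FirstOrder.Language.Term.var (Sum.inl i) => Nat.pair 0 i
  | FirstOrder.Language.Term.var (Sum.inr j) => Nat.pair 1 j
  | FirstOrder.Language.Term.func LinFunc.zero _ => Nat.pair 2 0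
  | FirstOrder.Language.Term.func LinFunc.one _ => Nat.pair 3 0
  | FirstOrder.Language.Term.func LinFunc.add ts =>
      Nat.pair 4 (Nat.pair (termCode (ts 0)) (termCode (ts 1)))

/-- Gödel number of a first-order formula of the language `<, +, 0, 1`. -/
def formulaCode {n : ℕ} : {k : ℕ} → linLang.BoundedFormula (Fin n) k → ℕ
  | _, FirstOrder.Language.BoundedFormula.falsum => Nat.pair 0 0
  | _, FirstOrder.Language.BoundedFormula.equal s t =>
      Nat.pair 1 (Nat.pair (termCode s) (termCode t))
  | _, FirstOrder.Language.BoundedFormula.rel LinRel.lt ts =>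
      Nat.pair 2 (Nat.pair (termCode (ts 0)) (termCode (ts 1)))
  | _, FirstOrder.Language.BoundedFormula.imp φ ψ =>
      Nat.pair 3 (Nat.pair (formulaCode φ) (formulaCode ψ))
  | _, FirstOrder.Language.BoundedFormula.all φ => Nat.pair 4 (formulaCode φ)

/-- First-order definability (without parameters) in `⟨ℝ, <, +, 0, 1⟩`. -/
abbrev LinDefinable {α : Type} (s : Set (α → ℝ)) : Prop :=
  (∅ : Set ℝ).Definable linLang s

/-! ## Games over dynamical systems -/

/-- A transition `(q, g, a, R, q')` with guard `g` and reset `R : V₂ → 2^{V₂}`. -/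
structure HybridEdge (Loc Act : Type) (k : ℕ) where
  src : Loc
  guard : Set (Fin k → ℝ)
  act : Act
  reset : (Fin k → ℝ) → Set (Fin k → ℝ)
  tgt : Loc

/-- An `𝓜`-game for `𝓜 = ⟨ℝ, <, +, 0, 1⟩`: finitely many locations, actions and transitions,
in every location `q` a dynamics `γ_q : V₁ × V → V₂`, and everything definable in `𝓜`.
The function `dyn q` matters only on `V₁ × V`, and a reset only on `V₂`. -/
structure HybridGame where
  Loc : Type
  Act : Type
  finite_loc : Finite Loc
  finite_act : Finite Act
  goal : Set Loc
  /-- The set `Σ_c` of controllable actions; `Σ_u` is its complement. -/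
  ctrl : Set Act
  k₁ : ℕ
  k₂ : ℕ
  V₁ : Set (Fin k₁ → ℝ)
  V : Set ℝ
  V₂ : Set (Fin k₂ → ℝ)
  edges : Set (HybridEdge Loc Act k₂)
  dyn : Loc → (Fin k₁ → ℝ) → ℝ → (Fin k₂ → ℝ)
  finite_edges : edges.Finite
  guard_sub : ∀ e ∈ edges, e.guard ⊆ V₂
  reset_sub : ∀ e ∈ edges, ∀ y ∈ V₂, e.reset y ⊆ V₂
  dyn_mem : ∀ q, ∀ x ∈ V₁, ∀ t ∈ V, dyn q x t ∈ V₂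
  guard_def : ∀ e ∈ edges, LinDefinable e.guard
  reset_def : ∀ e ∈ edges, LinDefinable {p : Fin k₂ ⊕ Fin k₂ → ℝ |
    p ∘ Sum.inl ∈ V₂ ∧ p ∘ Sum.inr ∈ e.reset (p ∘ Sum.inl)}
  dyn_def : ∀ q, LinDefinable {p : (Fin k₁ ⊕ Unit) ⊕ Fin k₂ → ℝ |
    p ∘ Sum.inl ∘ Sum.inl ∈ V₁ ∧ p (Sum.inl (Sum.inr ())) ∈ V ∧
      p ∘ Sum.inr = dyn q (p ∘ Sum.inl ∘ Sum.inl) (p (Sum.inl (Sum.inr ())))}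

namespace HybridGame

/-- A configuration `(q, x, t, y)` with `y = γ_q(x, t)`; the point `y` is `Config.pos`. -/
@[ext]
structure Config (G : HybridGame) where
  loc : G.Loc
  x : Fin G.k₁ → ℝ
  t : ℝ
  x_mem : x ∈ G.V₁
  t_mem : t ∈ G.V

/-- The point `y = γ_q(x, t)` of a configuration. -/
def Config.pos {G : HybridGame} (c : G.Config) : Fin G.k₂ → ℝ :=
  G.dyn c.loc c.x c.t

/-- `(q, x, t, y) --τ--> (q, x, t + τ, y')`. -/
def DelayStep (G : HybridGame) (τ : ℝ) (c c' : G.Config) : Prop :=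
  0 ≤ τ ∧ c'.loc = c.loc ∧ c'.x = c.x ∧ c'.t = c.t + τ

/-- `(q, x, t, y) --a--> (q', x', t', y')`. -/
def DiscreteStep (G : HybridGame) (a : G.Act) (c c' : G.Config) : Prop :=
  ∃ e ∈ G.edges, e.src = c.loc ∧ e.act = a ∧ e.tgt = c'.loc ∧
    c.pos ∈ e.guard ∧ c'.pos ∈ e.reset c.pos

/-- `(q, x, t, y) --τ,a--> (q', x', t', y')`: first a delay `τ`, then the action `a`. -/
def Step (G : HybridGame) (τ : ℝ) (a : G.Act) (c c' : G.Config) : Prop :=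
  ∃ d, G.DelayStep τ c d ∧ G.DiscreteStep a d c'

/-- `(τ, a)` is enabled in the configuration `c`. -/
def Enabled (G : HybridGame) (τ : ℝ) (a : G.Act) (c : G.Config) : Prop :=
  ∃ c', G.Step τ a c c'

/-- `FinRun G c d` is the type of finite runs of `G` from `c` to `d`. -/
inductive FinRun (G : HybridGame) : G.Config → G.Config → Type
  | nil (c : G.Config) : FinRun G c c
  | snoc {c d : G.Config} (ρ : FinRun G c d) (τ : ℝ) (a : G.Act) (e : G.Config)
      (h : G.Step τ a d e) : FinRun G c e

/-- Infinite runs of `G`. -/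
structure InfRun (G : HybridGame) where
  cfg : ℕ → G.Config
  delay : ℕ → ℝ
  act : ℕ → G.Act
  step : ∀ i, G.Step (delay i) (act i) (cfg i) (cfg (i + 1))

/-- The prefix of length `i` of an infinite run. -/
def InfRun.prefixRun {G : HybridGame} (r : G.InfRun) : (i : ℕ) → FinRun G (r.cfg 0) (r.cfg i)
  | 0 => FinRun.nil (r.cfg 0)
  | i + 1 => FinRun.snoc (r.prefixRun i) (r.delay i) (r.act i) (r.cfg (i + 1)) (r.step i)

/-- A strategy (under perfect observation): a partial function from finite runs to
`ℝ⁺ × Σ_c` whose value, where defined, is enabled in the last configuration of the run. -/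
structure Strategy (G : HybridGame) where
  choice : {c d : G.Config} → FinRun G c d → Option (ℝ × G.Act)
  valid : ∀ {c d : G.Config} (ρ : FinRun G c d) (τ : ℝ) (a : G.Act),
    choice ρ = some (τ, a) → a ∈ G.ctrl ∧ G.Enabled τ a d

/-- After the finite run `ρ`, the move `(τ', a')` is consistent with the strategy. -/
def Strategy.Allows {G : HybridGame} (s : G.Strategy) {c d : G.Config} (ρ : FinRun G c d)
    (τ' : ℝ) (a' : G.Act) : Prop :=
  ∀ τ a, s.choice ρ = some (τ, a) → (τ' = τ ∧ a' = a) ∨ (τ' ≤ τ ∧ a' ∉ G.ctrl)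

/-- A finite run is consistent with a strategy. -/
def FinRun.Consistent {G : HybridGame} (s : G.Strategy) :
    {c d : G.Config} → FinRun G c d → Prop
  | _, _, FinRun.nil _ => True
  | _, _, FinRun.snoc ρ τ a _ _ => ρ.Consistent s ∧ s.Allows ρ τ a

/-- An infinite run is consistent with a strategy. -/
def InfRun.Consistent {G : HybridGame} (s : G.Strategy) (r : G.InfRun) : Prop :=
  ∀ i, s.Allows (r.prefixRun i) (r.delay i) (r.act i)

/-- A finite run is winning: it visits a goal location. -/
def FinRun.Winning {G : HybridGame} : {c d : G.Config} → FinRun G c d → Prop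
  | c, _, FinRun.nil _ => c.loc ∈ G.goal
  | _, _, FinRun.snoc ρ _ _ e _ => ρ.Winning ∨ e.loc ∈ G.goal

/-- An infinite run is winning: it visits a goal location. -/
def InfRun.Winning {G : HybridGame} (r : G.InfRun) : Prop :=
  ∃ i, (r.cfg i).loc ∈ G.goal

/-- The strategy `s` is winning from `(q, y)`: for every `(x, t) ∈ V₁ × V` with
`γ_q(x, t) = y`, every run from `(q, x, t, y)` that is consistent with `s` and maximal with
respect to `s` (infinite, or finite with `s` undefined on it) is winning. -/
def Strategy.WinsFrom {G : HybridGame} (s : G.Strategy) (q : G.Loc) (y : Fin G.k₂ → ℝ) : Prop :=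
  ∀ c : G.Config, c.loc = q → c.pos = y →
    (∀ (d : G.Config) (ρ : FinRun G c d), ρ.Consistent s → s.choice ρ = none → ρ.Winning) ∧
    (∀ r : G.InfRun, r.cfg 0 = c → r.Consistent s → r.Winning)

/-- The set of winning states `(q, y)` under perfect observation. -/
def winningStates (G : HybridGame) : Set (G.Loc × (Fin G.k₂ → ℝ)) :=
  {p | p.2 ∈ G.V₂ ∧ ∃ s : G.Strategy, s.WinsFrom p.1 p.2}

end HybridGame

/-! ## Timed game automata -/

/-- Clock constraints over `n` clocks: Boolean combinations of `x ≤ c` and `c ≤ x`, where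
`c` is a nonnegative rational number. -/
inductive ClockConstraint (n : ℕ) : Type
  | le (i : Fin n) (c : ℚ≥0)
  | ge (i : Fin n) (c : ℚ≥0)
  | not (g : ClockConstraint n)
  | and (g h : ClockConstraint n)

namespace ClockConstraint

/-- Satisfaction of a clock constraint by a clock valuation. -/
def Sat {n : ℕ} : ClockConstraint n → (Fin n → ℝ) → Prop
  | le i c, v => v i ≤ (c : ℝ)
  | ge i c, v => (c : ℝ) ≤ v i
  | not g, v => ¬ g.Sat v
  | and g h, v => g.Sat v ∧ h.Sat v

/-- A natural number coding a clock constraint. -/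
def code {n : ℕ} : ClockConstraint n → ℕ
  | le i c => Nat.pair 0 (Nat.pair i (Nat.pair c.num c.den))
  | ge i c => Nat.pair 1 (Nat.pair i (Nat.pair c.num c.den))
  | not g => Nat.pair 2 g.code
  | and g h => Nat.pair 3 (Nat.pair g.code h.code)

end ClockConstraint

/-- A transition of a timed automaton; the clocks listed in `reset` are set to `0`. -/
structure TimedEdge (clocks locs acts : ℕ) where
  src : Fin locs
  guard : ClockConstraint clocks
  act : Fin acts
  reset : List (Fin clocks)
  tgt : Fin locs

/-- A timed automaton with a set of goal locations and with its actions partitioned into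
controllable ones (those listed in `ctrl`) and uncontrollable ones (the others). -/
structure TimedGame where
  clocks : ℕ
  locs : ℕ
  acts : ℕ
  goal : List (Fin locs)
  ctrl : List (Fin acts)
  edges : List (TimedEdge clocks locs acts)

/-- Codes of timed games. -/
abbrev TimedGameCode : Type :=
  ℕ × ℕ × ℕ × List ℕ × List ℕ × List (ℕ × ℕ × ℕ × List ℕ × ℕ)

/-- The code of a transition. -/
def TimedEdge.code {n m k : ℕ} (e : TimedEdge n m k) : ℕ × ℕ × ℕ × List ℕ × ℕ :=
  (e.src, e.guard.code, e.act, e.reset.map Fin.val, e.tgt)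

/-- The code of a timed game, which an algorithm receives as its input. -/
def TimedGame.code (A : TimedGame) : TimedGameCode :=
  (A.clocks, A.locs, A.acts, A.goal.map Fin.val, A.ctrl.map Fin.val,
    A.edges.map TimedEdge.code)

/-- The clock valuations `ℝ_{≥0}^n`. -/
def clockValuations (n : ℕ) : Set (Fin n → ℝ) := {v | ∀ i, 0 ≤ v i}

/-- The transition of the hybrid game given by a transition of a timed automaton. -/
def TimedEdge.toHybrid {n m k : ℕ} (e : TimedEdge n m k) : HybridEdge (Fin m) (Fin k) n where
  src := e.src
  guard := {v | v ∈ clockValuations n ∧ e.guard.Sat v}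
  act := e.act
  reset := fun v => {fun i => if i ∈ e.reset then 0 else v i}
  tgt := e.tgt

/-! ### Guards, resets and dynamics of timed automata are definable -/

theorem linDefinable_lt {α : Type} (s t : linLang.Term α) :
    LinDefinable {v : α → ℝ | s.realize v < t.realize v} := by
  rw [LinDefinable, Set.empty_definable_iff]
  refine ⟨FirstOrder.Language.Relations.formula₂ (L := linLang) LinRel.lt s t, ?_⟩
  ext v
  rw [Set.mem_ofPred_eq, Set.mem_ofPred_eq, FirstOrder.Language.Formula.realize_rel₂]
  rfl

theorem linDefinable_eq {α : Type} (s t : linLang.Term α) :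
    LinDefinable {v : α → ℝ | s.realize v = t.realize v} := by
  rw [LinDefinable, Set.empty_definable_iff]
  refine ⟨s.equal t, ?_⟩
  ext v
  simp [FirstOrder.Language.Formula.realize_equal]

/-- The term `s + t`. -/
def linAdd {α : Type} (s t : linLang.Term α) : linLang.Term α :=
  FirstOrder.Language.Term.func (L := linLang) LinFunc.add ![s, t]

/-- The constant `0`. -/
def linZero {α : Type} : linLang.Term α :=
  FirstOrder.Language.Term.func (L := linLang) LinFunc.zero ![]

/-- The constant `1`. -/
def linOne {α : Type} : linLang.Term α :=
  FirstOrder.Language.Term.func (L := linLang) LinFunc.one ![]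

/-- The term `t + ⋯ + t`. -/
def linMul {α : Type} : ℕ → linLang.Term α → linLang.Term α
  | 0, _ => linZero
  | k + 1, t => linAdd (linMul k t) t

theorem linAdd_realize {α : Type} (s t : linLang.Term α) (v : α → ℝ) :
    (linAdd s t).realize v = s.realize v + t.realize v := rfl

theorem linZero_realize {α : Type} (v : α → ℝ) : (linZero : linLang.Term α).realize v = 0 := rfl

theorem linOne_realize {α : Type} (v : α → ℝ) : (linOne : linLang.Term α).realize v = 1 := rfl

theorem linMul_realize {α : Type} (k : ℕ) (t : linLang.Term α) (v : α → ℝ) :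
    (linMul k t).realize v = k * t.realize v := by
  induction k with
  | zero => simp [linMul, linZero_realize]
  | succ k ih =>
    rw [linMul, linAdd_realize, ih]
    push_cast
    ring

theorem linDefinable_forall {α ι : Type} [Finite ι] {P : ι → (α → ℝ) → Prop}
    (h : ∀ i, LinDefinable {v | P i v}) : LinDefinable {v : α → ℝ | ∀ i, P i v} := by
  have := Set.definable_iInter_of_finite h
  rwa [← Set.ofPred_forall] at this

theorem clockValuations_definable {α : Type} {n : ℕ} (f : Fin n → α) :
    LinDefinable {v : α → ℝ | v ∘ f ∈ clockValuations n} := by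
  refine linDefinable_forall fun i => ?_
  convert (linDefinable_lt (FirstOrder.Language.Term.var (f i)) linZero).compl using 1
  ext v
  simp [linZero_realize]

theorem ClockConstraint.sat_definable {n : ℕ} (g : ClockConstraint n) :
    LinDefinable {v : Fin n → ℝ | g.Sat v} := by
  have key : ∀ c : ℚ≥0, (c : ℝ) = (c.num : ℝ) / (c.den : ℝ) := fun c => by
    conv_lhs => rw [← NNRat.num_div_den c]
    push_cast
    rfl
  have pos : ∀ c : ℚ≥0, (0 : ℝ) < c.den := fun c => by exact_mod_cast c.den_pos
  induction g with
  | le i c =>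
    convert (linDefinable_lt (linMul c.num linOne)
      (linMul c.den (FirstOrder.Language.Term.var i))).compl using 1
    ext v
    simp [Sat, linMul_realize, linOne_realize, key c, le_div_iff₀ (pos c), mul_comm]
  | ge i c =>
    convert (linDefinable_lt (linMul c.den (FirstOrder.Language.Term.var i))
      (linMul c.num linOne)).compl using 1
    ext v
    simp [Sat, linMul_realize, linOne_realize, key c, div_le_iff₀ (pos c), mul_comm]
  | not g ih => exact ih.compl
  | and g h ihg ihh => exact ihg.inter ihh

/-- The hybrid game of a timed game: the clocks range over `ℝ_{≥0}^n` and all increase with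
slope one, that is, `γ_q(x₁, …, xₙ, t) = (x₁ + t, …, xₙ + t)` for `t ≥ 0`. -/
def TimedGame.toHybrid (A : TimedGame) : HybridGame where
  Loc := Fin A.locs
  Act := Fin A.acts
  finite_loc := inferInstance
  finite_act := inferInstance
  goal := {q | q ∈ A.goal}
  ctrl := {a | a ∈ A.ctrl}
  k₁ := A.clocks
  k₂ := A.clocks
  V₁ := clockValuations A.clocks
  V := {t | 0 ≤ t}
  V₂ := clockValuations A.clocks
  edges := {e | ∃ e' ∈ A.edges, e = e'.toHybrid}
  dyn := fun _ x t i => x i + t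
  finite_edges := by
    refine ((List.finite_toSet A.edges).image TimedEdge.toHybrid).subset ?_
    rintro e ⟨e', h, rfl⟩
    exact ⟨e', h, rfl⟩
  guard_sub := by
    rintro e ⟨e', h, rfl⟩ v hv
    exact hv.1
  reset_sub := by
    rintro e ⟨e', h, rfl⟩ y hy z hz i
    rw [show z = _ from hz]
    dsimp only
    split_ifs
    · exact le_rfl
    · exact hy i
  dyn_mem := fun _ x hx t ht i => add_nonneg (hx i) ht
  guard_def := by
    rintro e ⟨e', h, rfl⟩
    exact (clockValuations_definable id).inter e'.guard.sat_definable
  reset_def := by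
    rintro e ⟨e', h, rfl⟩
    have key : ∀ i, LinDefinable {p : Fin A.clocks ⊕ Fin A.clocks → ℝ |
        p (Sum.inr i) = if i ∈ e'.reset then 0 else p (Sum.inl i)} := by
      intro i
      by_cases hi : i ∈ e'.reset
      · simp only [hi, if_true]
        exact linDefinable_eq (FirstOrder.Language.Term.var (Sum.inr i)) linZero
      · simp only [hi, if_false]
        exact linDefinable_eq (FirstOrder.Language.Term.var (Sum.inr i))
          (FirstOrder.Language.Term.var (Sum.inl i))
    convert (clockValuations_definable Sum.inl).inter (linDefinable_forall key) using 1
    ext p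
    exact and_congr_right fun _ => funext_iff
  dyn_def := by
    intro q
    have key : ∀ i, LinDefinable {p : (Fin A.clocks ⊕ Unit) ⊕ Fin A.clocks → ℝ |
        p (Sum.inr i) = p (Sum.inl (Sum.inl i)) + p (Sum.inl (Sum.inr ()))} := fun i =>
      linDefinable_eq (FirstOrder.Language.Term.var (Sum.inr i))
        (linAdd (FirstOrder.Language.Term.var (Sum.inl (Sum.inl i)))
          (FirstOrder.Language.Term.var (Sum.inl (Sum.inr ()))))
    have time : LinDefinable {p : (Fin A.clocks ⊕ Unit) ⊕ Fin A.clocks → ℝ |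
        0 ≤ p (Sum.inl (Sum.inr ()))} := by
      convert (linDefinable_lt (FirstOrder.Language.Term.var (Sum.inl (Sum.inr ())))
        linZero).compl using 1
      ext v
      simp [linZero_realize]
    convert (clockValuations_definable (Sum.inl ∘ Sum.inl)).inter
      (time.inter (linDefinable_forall key)) using 1
    ext p
    exact and_congr_right fun _ => and_congr_right fun _ => funext_iff

/-!
A timed game is won from a state exactly if the state lies in the *attractor* of the goal: the
least set that contains the goal states and is closed under the controllable predecessor operator
`TimedGame.cpre`. From a state of the `i`-th attractor the controller follows moves that decrease
`i` (`mem_winningStates_of_mem_attractor`). Outside of an attractor that is closed under `cpre` the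
opponent can answer every move so as to stay outside, and the resulting run, finite with the
strategy undefined or infinite, never visits a goal (`mem_attractor_of_mem_winningStates`).

The attractors become stationary because of *regions*. Let all constants of the guards be of the
form `k / D` with `k ≤ K`, and call two clock valuations equivalent if they satisfy the same
comparisons of clock differences with the numbers `k / D`, `|k| ≤ K`. For equivalent valuations the
delays at which a clock reaches such a constant have the same order type, so that a delay on one
side has a counterpart on the other (`exists_same_cut`). Hence equivalence is a bisimulation that
respects the comparison of the delays of the two players
(`TimedGame.Bounded.saturated_cpre`), every attractor is a union of regions, and the number of
regions, which is computable, bounds the number of moves needed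
(`TimedGame.Bounded.attractor_stationary`, `TimedGame.mem_winningStates_iff`).

Each single attractor is defined by a formula that quantifies over the delays of the two players.
No quantifier elimination is needed to write it down, only a primitive recursion over a tree of
transitions (`exists_primrec_attractorFormula`), which gives the second claim. The resets and delays
are carried along as terms for the clocks. Bound variables are numbered from the outside, so that
these terms keep their meaning below further quantifiers.

For the first claim, a point `y` that is defined by `φ` is winning exactly if
`∀ v, φ(v) → ψ(v)` is true, where `ψ` defines the winning states. The truth of sentences of
`⟨ℝ, <, +, 0, 1⟩` is decided by restricting the quantifiers to finite sets: the truth of a formula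
depends only on the signs of the integral linear forms with bounded coefficients
(`SameSigns.codeSat_iff`), by a back-and-forth argument that again uses `exists_same_cut`. After the
environment has been scaled, every real number may be replaced by an integer from an explicit
finite range (`codeSat_forall_iff`). For this reason the semantics `codeSat` treats the constant `1`
as one more entry of the environment.

Both algorithms are recursions over finitely branching trees, which `exists_primrec_treeRec` turns
into primitive recursive functions.
-/

/-! ### Recursion along finitely branching trees -/

/-- A function defined by recursion over finitely branching trees, whose node `b` has the
children `l b` and whose value at `b` is computed from the values at the children, is primitive
recursive as soon as `l`, the combination `g` and a decreasing measure `m` are. -/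
theorem exists_primrec_treeRec {β σ : Type} [Primcodable β] [Primcodable σ] {m : β → ℕ}
    {l : β → List β} {g : β → List σ → σ} (hm : Primrec m) (hl : Primrec l) (hg : Primrec₂ g)
    (ord : ∀ b, ∀ b' ∈ l b, m b' < m b) :
    ∃ f : β → σ, Primrec f ∧ ∀ b, f b = g b ((l b).map f) := by
  have hwf : WellFounded fun b' b : β => m b' < m b := (measure m).wf
  let f : β → σ := hwf.fix fun b F => g b ((l b).attach.map fun b' => F b'.1 (ord b b'.1 b'.2))
  have hf : ∀ b, f b = g b ((l b).map f) := by
    intro b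
    change hwf.fix _ b = _
    rw [hwf.fix_eq]
    congr 1
    exact List.attach_map_val (f := f) (l := l b)
  refine ⟨f, ?_, hf⟩
  exact Primrec.nat_omega_rec' f hm hl (Primrec.option_some.comp₂ hg) ord fun b => by rw [← hf b]

/-! ### Semantics of formulas on their Gödel numbers -/

theorem unpair_snd_lt {c : ℕ} (h : c.unpair.1 ≠ 0) : c.unpair.2 < c := by
  have h1 := Nat.add_le_pair c.unpair.1 c.unpair.2
  rw [Nat.pair_unpair] at h1
  omega

theorem unpair_snd_unpair_fst_lt {c : ℕ} (h : c.unpair.1 ≠ 0) : c.unpair.2.unpair.1 < c :=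
  (Nat.unpair_left_le _).trans_lt (unpair_snd_lt h)

theorem unpair_snd_unpair_snd_lt {c : ℕ} (h : c.unpair.1 ≠ 0) : c.unpair.2.unpair.2 < c :=
  (Nat.unpair_right_le _).trans_lt (unpair_snd_lt h)

/-- The value of the term with Gödel number `c` in an environment `l`. The first entry of `l` is
the value of the constant `1`, then come the values of the `n` free variables, then those of the
bound variables. -/
def termVal {R : Type} [AddCommMonoid R] (n : ℕ) (l : List R) (c : ℕ) : R :=
  if c.unpair.1 = 0 then l.getD (1 + c.unpair.2) 0
  else if c.unpair.1 = 1 then l.getD (1 + n + c.unpair.2) 0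
  else if c.unpair.1 = 2 then 0
  else if c.unpair.1 = 3 then l.getD 0 0
  else if c.unpair.1 = 4 then
    termVal n l c.unpair.2.unpair.1 + termVal n l c.unpair.2.unpair.2
  else 0
termination_by c
decreasing_by
  · exact unpair_snd_unpair_fst_lt (by omega)
  · exact unpair_snd_unpair_snd_lt (by omega)

/-- Truth of the formula with Gödel number `c` in an environment `l` of real numbers, laid out as
for `termVal`. The entry for the constant `1` is arbitrary, so that truth is invariant under
scaling of the environment. -/
def codeSat (n : ℕ) (c : ℕ) (l : List ℝ) : Prop :=
  if c.unpair.1 = 1 then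
    termVal n l c.unpair.2.unpair.1 = termVal n l c.unpair.2.unpair.2
  else if c.unpair.1 = 2 then
    termVal n l c.unpair.2.unpair.1 < termVal n l c.unpair.2.unpair.2
  else if c.unpair.1 = 3 then
    codeSat n c.unpair.2.unpair.1 l → codeSat n c.unpair.2.unpair.2 l
  else if c.unpair.1 = 4 then ∀ x : ℝ, codeSat n c.unpair.2 (l ++ [x])
  else False
termination_by c
decreasing_by
  · exact unpair_snd_unpair_fst_lt (by omega)
  · exact unpair_snd_unpair_snd_lt (by omega)
  · exact unpair_snd_lt (by omega)

section termVal

variable {R : Type} [AddCommMonoid R] (n : ℕ) (l : List R)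

@[simp] theorem termVal_free (i : ℕ) : termVal n l (Nat.pair 0 i) = l.getD (1 + i) 0 := by
  rw [termVal]; simp

@[simp] theorem termVal_bound (j : ℕ) : termVal n l (Nat.pair 1 j) = l.getD (1 + n + j) 0 := by
  rw [termVal]; simp

@[simp] theorem termVal_zero (j : ℕ) : termVal n l (Nat.pair 2 j) = 0 := by
  rw [termVal]; simp

@[simp] theorem termVal_one (j : ℕ) : termVal n l (Nat.pair 3 j) = l.getD 0 0 := by
  rw [termVal]; simp

@[simp] theorem termVal_add (s t : ℕ) :
    termVal n l (Nat.pair 4 (Nat.pair s t)) = termVal n l s + termVal n l t := by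
  rw [termVal]; simp

theorem termVal_map {S : Type} [AddCommMonoid S] (f : R →+ S) (c : ℕ) :
    termVal n (l.map f) c = f (termVal n l c) := by
  have hd : ∀ i, (l.map f).getD i 0 = f (l.getD i 0) := fun i => by
    have := List.getD_map (l := l) (d := 0) (n := i) f
    rwa [map_zero] at this
  induction c using Nat.strong_induction_on with
  | _ c ih =>
    rw [termVal.eq_def n (l.map f) c, termVal.eq_def n l c]
    split_ifs with h0 h1 h2 h3 h4
    · exact hd _
    · exact hd _
    · rw [map_zero]
    · exact hd _
    · rw [ih _ (unpair_snd_unpair_fst_lt h0), ih _ (unpair_snd_unpair_snd_lt h0), map_add]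
    · rw [map_zero]

end termVal

section codeSat

variable (n : ℕ) (l : List ℝ)

@[simp] theorem codeSat_falsum : codeSat n (Nat.pair 0 0) l ↔ False := by
  rw [codeSat]; simp

@[simp] theorem codeSat_equal (s t : ℕ) :
    codeSat n (Nat.pair 1 (Nat.pair s t)) l ↔ termVal n l s = termVal n l t := by
  rw [codeSat]; simp

@[simp] theorem codeSat_lt (s t : ℕ) :
    codeSat n (Nat.pair 2 (Nat.pair s t)) l ↔ termVal n l s < termVal n l t := by
  rw [codeSat]; simp

@[simp] theorem codeSat_imp (s t : ℕ) :
    codeSat n (Nat.pair 3 (Nat.pair s t)) l ↔ (codeSat n s l → codeSat n t l) := by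
  rw [codeSat]; simp

@[simp] theorem codeSat_all (s : ℕ) :
    codeSat n (Nat.pair 4 s) l ↔ ∀ x : ℝ, codeSat n s (l ++ [x]) := by
  rw [codeSat]; simp

end codeSat

/-- The environment of a valuation of the free variables and of the bound variables. -/
def realEnv {n k : ℕ} (v : Fin n → ℝ) (z : Fin k → ℝ) : List ℝ :=
  1 :: (List.ofFn v ++ List.ofFn z)

theorem realEnv_getD_free {n k : ℕ} (v : Fin n → ℝ) (z : Fin k → ℝ) (i : Fin n) :
    (realEnv v z).getD (1 + i) 0 = v i := by
  rw [realEnv, add_comm, List.getD_cons_succ, List.getD_append _ _ _ _ (by simp)]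
  simp [List.getD_eq_getElem?_getD]

theorem realEnv_getD_bound {n k : ℕ} (v : Fin n → ℝ) (z : Fin k → ℝ) (j : Fin k) :
    (realEnv v z).getD (1 + n + j) 0 = z j := by
  rw [realEnv, show 1 + n + (j : ℕ) = n + j + 1 by ring, List.getD_cons_succ,
    List.getD_append_right _ _ _ _ (by simp)]
  simp [List.getD_eq_getElem?_getD]

theorem realEnv_snoc {n k : ℕ} (v : Fin n → ℝ) (z : Fin k → ℝ) (x : ℝ) :
    realEnv v (Fin.snoc z x : Fin (k + 1) → ℝ) = realEnv v z ++ [x] := by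
  simp [realEnv, List.ofFn_succ', List.concat_eq_append, -List.ofFn_succ]

theorem realize_term_iff_termVal {n k : ℕ} (v : Fin n → ℝ) (z : Fin k → ℝ)
    (t : linLang.Term (Fin n ⊕ Fin k)) :
    t.realize (Sum.elim v z) = termVal n (realEnv v z) (termCode t) := by
  induction t with
  | var i =>
    rcases i with i | j
    · simp only [termCode, termVal_free, realEnv_getD_free]; rfl
    · simp only [termCode, termVal_bound, realEnv_getD_bound]; rfl
  | func f ts ih =>
    cases f with
    | zero => simp only [termCode, termVal_zero]; rfl
    | one => simp only [termCode, termVal_one]; rfl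
    | add =>
      simp only [termCode, termVal_add, ← ih]
      rfl

/-- The semantics on Gödel numbers agrees with first-order satisfaction in `⟨ℝ, <, +, 0, 1⟩`. -/
theorem realize_iff_codeSat {n k : ℕ} (φ : linLang.BoundedFormula (Fin n) k) (v : Fin n → ℝ)
    (z : Fin k → ℝ) : φ.Realize v z ↔ codeSat n (formulaCode φ) (realEnv v z) := by
  induction φ with
  | falsum => simp only [formulaCode, codeSat_falsum]; rfl
  | equal s t =>
    simp only [formulaCode, codeSat_equal, ← realize_term_iff_termVal]; rfl
  | rel R ts =>
    cases R
    simp only [formulaCode, codeSat_lt, ← realize_term_iff_termVal]; rfl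
  | imp φ ψ ihφ ihψ =>
    rw [FirstOrder.Language.BoundedFormula.realize_imp, ihφ, ihψ, formulaCode, codeSat_imp]
  | all φ ih =>
    rw [FirstOrder.Language.BoundedFormula.realize_all, formulaCode, codeSat_all]
    refine forall_congr' fun x => ?_
    rw [ih, realEnv_snoc]

/-! ### Building Gödel numbers of formulas -/

/-- `c` is the Gödel number of a term with `n` free and `k` bound variables. -/
def IsTermCode (n k c : ℕ) : Prop :=
  ∃ t : linLang.Term (Fin n ⊕ Fin k), termCode t = c

/-- `c` is the Gödel number of a formula with `n` free and `k` bound variables. -/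
def IsFormulaCode (n k c : ℕ) : Prop :=
  ∃ φ : linLang.BoundedFormula (Fin n) k, formulaCode φ = c

/-- Gödel number of `s + t`. -/
def addCode (s t : ℕ) : ℕ := Nat.pair 4 (Nat.pair s t)
/-- Gödel number of `0`. -/
def zeroCode : ℕ := Nat.pair 2 0
/-- Gödel number of `1`. -/
def oneCode : ℕ := Nat.pair 3 0
/-- Gödel number of `t + ⋯ + t`. -/
def mulCode (m t : ℕ) : ℕ := Nat.rec zeroCode (fun _ s => addCode s t) m
/-- Gödel number of `s < t`. -/
def ltCode (s t : ℕ) : ℕ := Nat.pair 2 (Nat.pair s t)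
/-- Gödel number of `⊥`. -/
def falseCode : ℕ := Nat.pair 0 0
/-- Gödel number of `φ → ψ`. -/
def impCode (a b : ℕ) : ℕ := Nat.pair 3 (Nat.pair a b)
/-- Gödel number of `¬ φ`. -/
def notCode (a : ℕ) : ℕ := impCode a falseCode
/-- Gödel number of `φ ∧ ψ`. -/
def andCode (a b : ℕ) : ℕ := notCode (impCode a (notCode b))
/-- Gödel number of `φ ∨ ψ`. -/
def orCode (a b : ℕ) : ℕ := impCode (notCode a) b
/-- Gödel number of `∀ z, φ`. -/
def allCode (a : ℕ) : ℕ := Nat.pair 4 a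
/-- Gödel number of `∃ z, φ`. -/
def exCode (a : ℕ) : ℕ := notCode (allCode (notCode a))
/-- Gödel number of the conjunction of a list of formulas. -/
def conjCode (L : List ℕ) : ℕ := L.foldr (fun a s => andCode a s) (notCode falseCode)
/-- Gödel number of the disjunction of a list of formulas. -/
def disjCode (L : List ℕ) : ℕ := L.foldr (fun a s => orCode a s) falseCode

section combinators

variable {n k : ℕ}

theorem IsTermCode.free (k : ℕ) {i : ℕ} (hi : i < n) : IsTermCode n k (Nat.pair 0 i) :=
  ⟨.var (Sum.inl ⟨i, hi⟩), by simp [termCode]⟩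

theorem IsTermCode.bound (n : ℕ) {j : ℕ} (hj : j < k) : IsTermCode n k (Nat.pair 1 j) :=
  ⟨.var (Sum.inr ⟨j, hj⟩), by simp [termCode]⟩

theorem IsTermCode.zero (n k : ℕ) : IsTermCode n k zeroCode :=
  ⟨linZero, by simp [linZero, termCode, zeroCode]⟩

theorem IsTermCode.one (n k : ℕ) : IsTermCode n k oneCode :=
  ⟨linOne, by simp [linOne, termCode, oneCode]⟩

theorem IsTermCode.add {s t : ℕ} (hs : IsTermCode n k s) (ht : IsTermCode n k t) :
    IsTermCode n k (addCode s t) := by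
  obtain ⟨s, rfl⟩ := hs
  obtain ⟨t, rfl⟩ := ht
  exact ⟨linAdd s t, by simp [linAdd, termCode, addCode]⟩

theorem IsTermCode.mul {t : ℕ} (ht : IsTermCode n k t) (m : ℕ) : IsTermCode n k (mulCode m t) := by
  induction m with
  | zero => exact IsTermCode.zero n k
  | succ m ih => exact ih.add ht

theorem IsFormulaCode.false (n k : ℕ) : IsFormulaCode n k falseCode :=
  ⟨.falsum, by simp [formulaCode, falseCode]⟩

theorem IsFormulaCode.lt {s t : ℕ} (hs : IsTermCode n k s) (ht : IsTermCode n k t) :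
    IsFormulaCode n k (ltCode s t) := by
  obtain ⟨s, rfl⟩ := hs
  obtain ⟨t, rfl⟩ := ht
  exact ⟨.rel LinRel.lt ![s, t], by simp [formulaCode, ltCode]⟩

theorem IsFormulaCode.imp {a b : ℕ} (ha : IsFormulaCode n k a) (hb : IsFormulaCode n k b) :
    IsFormulaCode n k (impCode a b) := by
  obtain ⟨φ, rfl⟩ := ha
  obtain ⟨ψ, rfl⟩ := hb
  exact ⟨.imp φ ψ, by simp [formulaCode, impCode]⟩

theorem IsFormulaCode.not {a : ℕ} (ha : IsFormulaCode n k a) : IsFormulaCode n k (notCode a) :=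
  ha.imp (.false n k)

theorem IsFormulaCode.and {a b : ℕ} (ha : IsFormulaCode n k a) (hb : IsFormulaCode n k b) :
    IsFormulaCode n k (andCode a b) :=
  (ha.imp hb.not).not

theorem IsFormulaCode.or {a b : ℕ} (ha : IsFormulaCode n k a) (hb : IsFormulaCode n k b) :
    IsFormulaCode n k (orCode a b) :=
  ha.not.imp hb

theorem IsFormulaCode.all {a : ℕ} (ha : IsFormulaCode n (k + 1) a) :
    IsFormulaCode n k (allCode a) := by
  obtain ⟨φ, rfl⟩ := ha
  exact ⟨.all φ, by simp [formulaCode, allCode]⟩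

theorem IsFormulaCode.ex {a : ℕ} (ha : IsFormulaCode n (k + 1) a) :
    IsFormulaCode n k (exCode a) :=
  ha.not.all.not

theorem IsFormulaCode.conj {L : List ℕ} (h : ∀ a ∈ L, IsFormulaCode n k a) :
    IsFormulaCode n k (conjCode L) := by
  induction L with
  | nil => exact (IsFormulaCode.false n k).not
  | cons a L ih =>
    exact (h a (by simp)).and (ih fun b hb => h b (by simp [hb]))

theorem IsFormulaCode.disj {L : List ℕ} (h : ∀ a ∈ L, IsFormulaCode n k a) :
    IsFormulaCode n k (disjCode L) := by
  induction L with
  | nil => exact IsFormulaCode.false n k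
  | cons a L ih =>
    exact (h a (by simp)).or (ih fun b hb => h b (by simp [hb]))

theorem IsTermCode.succ {t : ℕ} (ht : IsTermCode n k t) : IsTermCode n (k + 1) t := by
  obtain ⟨t, rfl⟩ := ht
  refine ⟨t.relabel (Sum.map id Fin.castSucc), ?_⟩
  induction t with
  | var i => rcases i with i | j <;> simp [termCode, FirstOrder.Language.Term.relabel]
  | func f ts ih =>
    cases f with
    | zero => simp [termCode, FirstOrder.Language.Term.relabel]
    | one => simp [termCode, FirstOrder.Language.Term.relabel]
    | add =>
      simp only [FirstOrder.Language.Term.relabel, termCode]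
      rw [← ih 0, ← ih 1]

/-- The value of a term depends only on the part of the environment that it mentions. -/
theorem IsTermCode.termVal_append {t : ℕ} (ht : IsTermCode n k t) {l : List ℝ}
    (hl : l.length = 1 + n + k) (x : ℝ) : termVal n (l ++ [x]) t = termVal n l t := by
  obtain ⟨t, rfl⟩ := ht
  induction t with
  | var i =>
    rcases i with i | j
    · simp only [termCode, termVal_free]
      exact List.getD_append _ _ _ _ (by omega)
    · simp only [termCode, termVal_bound]
      exact List.getD_append _ _ _ _ (by omega)
  | func f ts ih =>
    cases f with
    | zero => simp [termCode]
    | one =>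
      simp only [termCode, termVal_one]
      exact List.getD_append _ _ _ _ (by omega)
    | add => simp only [termCode, termVal_add, ih]

variable (n) (l : List ℝ)

theorem termVal_addCode (s t : ℕ) :
    termVal n l (addCode s t) = termVal n l s + termVal n l t :=
  termVal_add n l s t

theorem termVal_zeroCode : termVal n l zeroCode = 0 := termVal_zero n l 0

theorem termVal_oneCode : termVal n l oneCode = l.getD 0 0 := termVal_one n l 0

theorem termVal_mulCode (m t : ℕ) : termVal n l (mulCode m t) = m * termVal n l t := by
  induction m with
  | zero => rw [Nat.cast_zero, zero_mul]; exact termVal_zeroCode n l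
  | succ m ih =>
    change termVal n l (addCode (mulCode m t) t) = _
    rw [termVal_addCode, ih]
    push_cast
    ring

theorem codeSat_ltCode (s t : ℕ) :
    codeSat n (ltCode s t) l ↔ termVal n l s < termVal n l t :=
  codeSat_lt n l s t

theorem codeSat_falseCode : ¬ codeSat n falseCode l := by simp [falseCode]

theorem codeSat_impCode (a b : ℕ) :
    codeSat n (impCode a b) l ↔ (codeSat n a l → codeSat n b l) :=
  codeSat_imp n l a b

theorem codeSat_notCode (a : ℕ) : codeSat n (notCode a) l ↔ ¬ codeSat n a l := by
  rw [notCode, codeSat_impCode]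
  simp only [codeSat_falseCode, imp_false]

theorem codeSat_andCode (a b : ℕ) :
    codeSat n (andCode a b) l ↔ codeSat n a l ∧ codeSat n b l := by
  rw [andCode, codeSat_notCode, codeSat_impCode, codeSat_notCode]
  tauto

theorem codeSat_orCode (a b : ℕ) :
    codeSat n (orCode a b) l ↔ codeSat n a l ∨ codeSat n b l := by
  rw [orCode, codeSat_impCode, codeSat_notCode]
  tauto

theorem codeSat_allCode (a : ℕ) :
    codeSat n (allCode a) l ↔ ∀ x : ℝ, codeSat n a (l ++ [x]) :=
  codeSat_all n l a

theorem codeSat_exCode (a : ℕ) :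
    codeSat n (exCode a) l ↔ ∃ x : ℝ, codeSat n a (l ++ [x]) := by
  rw [exCode, codeSat_notCode, codeSat_allCode]
  simp only [codeSat_notCode, not_forall, not_not]

theorem codeSat_conjCode (L : List ℕ) :
    codeSat n (conjCode L) l ↔ ∀ a ∈ L, codeSat n a l := by
  induction L with
  | nil =>
    change codeSat n (notCode falseCode) l ↔ _
    simp [codeSat_notCode, codeSat_falseCode]
  | cons a L ih =>
    change codeSat n (andCode a (conjCode L)) l ↔ _
    simp [codeSat_andCode, ih]

theorem codeSat_disjCode (L : List ℕ) :
    codeSat n (disjCode L) l ↔ ∃ a ∈ L, codeSat n a l := by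
  induction L with
  | nil =>
    change codeSat n falseCode l ↔ _
    simp [codeSat_falseCode]
  | cons a L ih =>
    change codeSat n (orCode a (disjCode L)) l ↔ _
    simp [codeSat_orCode, ih]

end combinators

section primrec

variable {α : Type} [Primcodable α] {f g : α → ℕ}

theorem primrec_pairConst (t : ℕ) (hf : Primrec f) : Primrec fun a => Nat.pair t (f a) :=
  Primrec₂.natPair.comp (.const t) hf

theorem primrec_addCode (hf : Primrec f) (hg : Primrec g) :
    Primrec fun a => addCode (f a) (g a) :=
  primrec_pairConst 4 (Primrec₂.natPair.comp hf hg)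

theorem primrec_mulCode (hf : Primrec f) (hg : Primrec g) :
    Primrec fun a => mulCode (f a) (g a) :=
  Primrec.nat_rec' hf (.const zeroCode)
    (primrec_addCode (Primrec.snd.comp Primrec.snd) (hg.comp Primrec.fst)).to₂

theorem primrec_ltCode (hf : Primrec f) (hg : Primrec g) :
    Primrec fun a => ltCode (f a) (g a) :=
  primrec_pairConst 2 (Primrec₂.natPair.comp hf hg)

theorem primrec_impCode (hf : Primrec f) (hg : Primrec g) :
    Primrec fun a => impCode (f a) (g a) :=
  primrec_pairConst 3 (Primrec₂.natPair.comp hf hg)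

theorem primrec_notCode (hf : Primrec f) : Primrec fun a => notCode (f a) :=
  primrec_impCode hf (.const _)

theorem primrec_andCode (hf : Primrec f) (hg : Primrec g) :
    Primrec fun a => andCode (f a) (g a) :=
  primrec_notCode (primrec_impCode hf (primrec_notCode hg))

theorem primrec_orCode (hf : Primrec f) (hg : Primrec g) :
    Primrec fun a => orCode (f a) (g a) :=
  primrec_impCode (primrec_notCode hf) hg

theorem primrec_allCode (hf : Primrec f) : Primrec fun a => allCode (f a) :=
  primrec_pairConst 4 hf

theorem primrec_exCode (hf : Primrec f) : Primrec fun a => exCode (f a) :=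
  primrec_notCode (primrec_allCode (primrec_notCode hf))

theorem primrec_conjCode {F : α → List ℕ} (hF : Primrec F) : Primrec fun a => conjCode (F a) :=
  Primrec.list_foldr hF (.const _)
    (primrec_andCode (Primrec.fst.comp Primrec.snd) (Primrec.snd.comp Primrec.snd)).to₂

theorem primrec_disjCode {F : α → List ℕ} (hF : Primrec F) : Primrec fun a => disjCode (F a) :=
  Primrec.list_foldr hF (.const _)
    (primrec_orCode (Primrec.fst.comp Primrec.snd) (Primrec.snd.comp Primrec.snd)).to₂

end primrec

/-! ### Finite order types -/

/-- If two finite families of reals have the same order type, then every real `τ` has a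
counterpart `τ'` that lies in the second family as `τ` lies in the first. It can be chosen as a
midpoint of two points of the second family, or at distance `1` from one of them. -/
theorem exists_same_cut {ι : Type} [Finite ι] [Nonempty ι] {p p' : ι → ℝ}
    (h : ∀ i j, p i < p j ↔ p' i < p' j) (τ : ℝ) :
    ∃ τ', (∀ i, p i < τ ↔ p' i < τ') ∧ (∀ i, τ < p i ↔ τ' < p' i) ∧
      ∃ i j, τ' = (p' i + p' j) / 2 ∨ τ' = p' i + 1 ∨ τ' = p' i - 1 := by
  by_cases hτ : ∃ i, p i = τ
  · obtain ⟨i, rfl⟩ := hτ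
    exact ⟨p' i, fun j => h j i, fun j => h i j, i, i, Or.inl (by ring)⟩
  push Not at hτ
  have hL : ∀ s : Set ι, s.Nonempty → (∃ i ∈ s, ∀ j ∈ s, p' j ≤ p' i) ∧
      ∃ i ∈ s, ∀ j ∈ s, p' i ≤ p' j := fun s hs =>
    ⟨s.toFinite.exists_maximalFor p' s hs |>.imp fun i hi =>
      ⟨hi.1, fun j hj => (le_total (p' j) (p' i)).elim id fun h' => hi.2 hj h'⟩,
     s.toFinite.exists_minimalFor p' s hs |>.imp fun i hi =>
      ⟨hi.1, fun j hj => (le_total (p' i) (p' j)).elim id fun h' => hi.2 hj h'⟩⟩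
  -- it suffices to separate the points below `τ` from those above `τ`
  have key : ∀ τ', (∀ i, p i < τ → p' i < τ') → (∀ i, τ < p i → τ' < p' i) →
      (∀ i, p i < τ ↔ p' i < τ') ∧ (∀ i, τ < p i ↔ τ' < p' i) := by
    intro τ' h1 h2
    refine ⟨fun i => ⟨h1 i, fun h' => ?_⟩, fun i => ⟨h2 i, fun h' => ?_⟩⟩
    · exact (hτ i).lt_or_gt.resolve_right fun h'' => (h2 i h'').asymm h'
    · exact (hτ i).lt_or_gt.resolve_left fun h'' => (h1 i h'').asymm h'
  by_cases hlo : ∃ i, p i < τ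
  · obtain ⟨⟨a, ha, hamax⟩, -⟩ := hL {i | p i < τ} hlo
    by_cases hhi : ∃ i, τ < p i
    · obtain ⟨-, b, hb, hbmin⟩ := hL {i | τ < p i} hhi
      have hab : p' a < p' b := (h a b).1 (lt_trans ha hb)
      obtain ⟨h1, h2⟩ := key ((p' a + p' b) / 2)
        (fun i hi => by linarith [hamax i hi]) (fun i hi => by linarith [hbmin i hi])
      exact ⟨_, h1, h2, a, b, Or.inl rfl⟩
    · obtain ⟨h1, h2⟩ := key (p' a + 1)
        (fun i hi => by linarith [hamax i hi]) (fun i hi => absurd ⟨i, hi⟩ hhi)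
      exact ⟨_, h1, h2, a, a, Or.inr (Or.inl rfl)⟩
  · obtain ⟨i₀⟩ := ‹Nonempty ι›
    have hhi : ∃ i, τ < p i :=
      ⟨i₀, (hτ i₀).lt_or_gt.resolve_left fun h' => hlo ⟨i₀, h'⟩⟩
    obtain ⟨-, b, hb, hbmin⟩ := hL {i | τ < p i} hhi
    obtain ⟨h1, h2⟩ := key (p' b - 1)
      (fun i hi => absurd ⟨i, hi⟩ hlo) (fun i hi => by linarith [hbmin i hi])
    exact ⟨_, h1, h2, b, b, Or.inr (Or.inr rfl)⟩

/-! ### Environments that satisfy the same linear inequalities -/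

/-- The value at the environment `l` of the linear form with coefficients `c`. -/
def linForm (c : ℕ → ℤ) (l : List ℝ) : ℝ :=
  ∑ i ∈ Finset.range l.length, (c i : ℝ) * l.getD i 0

/-- Two environments of the same length give the same sign to every linear form whose
coefficients are integers of absolute value at most `B`. -/
def SameSigns (B : ℕ) (l l' : List ℝ) : Prop :=
  l.length = l'.length ∧
    ∀ c : ℕ → ℤ, (∀ i, |c i| ≤ B) → (0 < linForm c l ↔ 0 < linForm c l')

theorem SameSigns.mono {B B' : ℕ} {l l' : List ℝ} (h : SameSigns B' l l') (hB : B ≤ B') :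
    SameSigns B l l' :=
  ⟨h.1, fun c hc => h.2 c fun i => (hc i).trans (by exact_mod_cast hB)⟩

theorem SameSigns.symm {B : ℕ} {l l' : List ℝ} (h : SameSigns B l l') : SameSigns B l' l :=
  ⟨h.1.symm, fun c hc => (h.2 c hc).symm⟩

theorem SameSigns.refl (B : ℕ) (l : List ℝ) : SameSigns B l l :=
  ⟨rfl, fun _ _ => Iff.rfl⟩

theorem linForm_append (c : ℕ → ℤ) (l : List ℝ) (x : ℝ) :
    linForm c (l ++ [x]) = linForm c l + c l.length * x := by
  rw [linForm, List.length_append, List.length_singleton, Finset.sum_range_succ, linForm]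
  congr 1
  · refine Finset.sum_congr rfl fun i hi => ?_
    rw [List.getD_append _ _ _ _ (Finset.mem_range.1 hi)]
  · rw [List.getD_append_right _ _ _ _ le_rfl]
    simp

theorem linForm_neg (c : ℕ → ℤ) (l : List ℝ) : linForm (fun i => -c i) l = -linForm c l := by
  simp [linForm, Finset.sum_neg_distrib]

theorem linForm_sub (a b : ℤ) (c c' : ℕ → ℤ) (l : List ℝ) :
    linForm (fun i => a * c i - b * c' i) l = a * linForm c l - b * linForm c' l := by
  simp only [linForm, Finset.mul_sum, ← Finset.sum_sub_distrib]
  refine Finset.sum_congr rfl fun i _ => ?_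
  push_cast
  ring

theorem linForm_smul (s : ℝ) (c : ℕ → ℤ) (l : List ℝ) :
    linForm c (l.map (s * ·)) = s * linForm c l := by
  rw [linForm, List.length_map, linForm, Finset.mul_sum]
  refine Finset.sum_congr rfl fun i _ => ?_
  have := List.getD_map (l := l) (d := 0) (n := i) (s * ·)
  rw [mul_zero] at this
  rw [this]
  ring

theorem SameSigns.smul (B : ℕ) (l : List ℝ) {s : ℝ} (hs : 0 < s) :
    SameSigns B l (l.map (s * ·)) :=
  ⟨by simp, fun c _ => by rw [linForm_smul, mul_pos_iff_of_pos_left hs]⟩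

theorem linForm_congr {c c' : ℕ → ℤ} {l : List ℝ} (h : ∀ i < l.length, c i = c' i) :
    linForm c l = linForm c' l :=
  Finset.sum_congr rfl fun i hi => by rw [h i (Finset.mem_range.1 hi)]

/-- Indices of the thresholds `- L(l) / c` at which the sign of `L(l) + c x` changes, where
`0 < c ≤ B` and the coefficients of `L` are bounded by `B`. -/
abbrev ThresholdIndex (B r : ℕ) : Type :=
  Fin B × (Fin r → Set.Icc (-(B : ℤ)) B)

/-- The coefficients of the linear form belonging to a threshold. -/
def ThresholdIndex.coeff {B r : ℕ} (p : ThresholdIndex B r) (i : ℕ) : ℤ :=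
  if h : i < r then p.2 ⟨i, h⟩ else 0

theorem ThresholdIndex.abs_coeff_le {B r : ℕ} (p : ThresholdIndex B r) (i : ℕ) :
    |p.coeff i| ≤ B := by
  unfold coeff
  split_ifs with h
  · exact abs_le.2 (p.2 ⟨i, h⟩).2
  · simp

/-- The value of `x` at which `L(l) + c x` changes its sign. -/
noncomputable def threshold {B r : ℕ} (l : List ℝ) (p : ThresholdIndex B r) : ℝ :=
  -linForm p.coeff l / ((p.1 : ℕ) + 1 : ℕ)

/-- Back and forth: environments that agree on the linear forms with coefficients up to `2 B²`
can be extended so as to agree on those with coefficients up to `B`, and the new entry can be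
found among finitely many explicit values. -/
theorem SameSigns.exists_append {B : ℕ} (hB : 1 ≤ B) {l l' : List ℝ}
    (h : SameSigns (2 * B ^ 2) l l') (x : ℝ) :
    ∃ x', SameSigns B (l ++ [x]) (l' ++ [x']) ∧ ∃ p q : ThresholdIndex B l.length,
      x' = (threshold l' p + threshold l' q) / 2 ∨ x' = threshold l' p + 1 ∨
        x' = threshold l' p - 1 := by
  have : Nonempty (ThresholdIndex B l.length) := ⟨⟨⟨0, hB⟩, fun _ => ⟨0, by simp⟩⟩⟩
  have hpos : ∀ p : ThresholdIndex B l.length, (0 : ℝ) < ((p.1 : ℕ) + 1 : ℕ) := fun p => by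
    positivity
  have hle : ∀ p : ThresholdIndex B l.length, |(((p.1 : ℕ) + 1 : ℕ) : ℤ)| ≤ B := fun p => by
    rw [abs_of_nonneg (by positivity)]
    exact_mod_cast p.1.2
  have hord : ∀ p q : ThresholdIndex B l.length,
      threshold l p < threshold l q ↔ threshold l' p < threshold l' q := by
    intro p q
    have key : ∀ m : List ℝ, threshold m p < threshold m q ↔
        0 < linForm (fun i => (((q.1 : ℕ) + 1 : ℕ) : ℤ) * p.coeff i -
          (((p.1 : ℕ) + 1 : ℕ) : ℤ) * q.coeff i) m := by
      intro m
      rw [linForm_sub, threshold, threshold, div_lt_div_iff₀ (hpos p) (hpos q)]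
      simp only [Int.cast_natCast]
      constructor <;> intro h' <;> linarith
    rw [key l, key l']
    refine h.2 _ fun i => (abs_sub _ _).trans ?_
    rw [abs_mul, abs_mul]
    have h1 := mul_le_mul (hle q) (p.abs_coeff_le i) (abs_nonneg _) (by positivity)
    have h2 := mul_le_mul (hle p) (q.abs_coeff_le i) (abs_nonneg _) (by positivity)
    push_cast at h1 h2 ⊢
    nlinarith
  obtain ⟨x', h1, h2, h3⟩ := exists_same_cut hord x
  refine ⟨x', ⟨by simp [h.1], fun c hc => ?_⟩, h3⟩
  rw [linForm_append, linForm_append, ← h.1]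
  -- the threshold of the form with coefficients `c`, up to sign
  have idx : ∀ d : ℕ → ℤ, (∀ i, |d i| ≤ B) → 0 < d l.length →
      ∃ p : ThresholdIndex B l.length, ∀ m : List ℝ, m.length = l.length →
        threshold m p = -linForm d m / d l.length := by
    intro d hd hpos
    have hd' := (abs_le.1 (hd l.length)).2
    refine ⟨⟨⟨(d l.length - 1).toNat, by omega⟩, fun i => ⟨d i, abs_le.1 (hd i)⟩⟩,
      fun m hm => ?_⟩
    rw [threshold]
    have e1 : ((((d l.length - 1).toNat + 1 : ℕ) : ℤ)) = d l.length := by omega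
    have e2 : ((((d l.length - 1).toNat + 1 : ℕ) : ℝ)) = d l.length := by exact_mod_cast e1
    rw [e2]
    congr 2
    refine linForm_congr fun i hi => ?_
    rw [hm] at hi
    simp [ThresholdIndex.coeff, hi]
  rcases lt_trichotomy (c l.length) 0 with hneg | h0 | hpos'
  · obtain ⟨p, hp⟩ := idx (fun i => -c i) (fun i => by simpa using hc i) (by simpa using hneg)
    have hneg' : (c l.length : ℝ) < 0 := by exact_mod_cast hneg
    have key : ∀ (m : List ℝ), m.length = l.length → ∀ y : ℝ,
        (0 < linForm c m + c l.length * y ↔ y < threshold m p) := by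
      intro m hm y
      rw [hp m hm, linForm_neg]
      push_cast
      rw [lt_div_iff₀ (by linarith)]
      constructor <;> intro h' <;> linarith
    rw [key l rfl, key l' h.1.symm, h2 p]
  · simp only [h0, Int.cast_zero, zero_mul, add_zero]
    exact (h.mono (by nlinarith)).2 c hc
  · obtain ⟨p, hp⟩ := idx c hc hpos'
    have hpos' : (0 : ℝ) < c l.length := by exact_mod_cast hpos'
    have key : ∀ (m : List ℝ), m.length = l.length → ∀ y : ℝ,
        (0 < linForm c m + c l.length * y ↔ threshold m p < y) := by
      intro m hm y
      rw [hp m hm, div_lt_iff₀ hpos']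
      constructor <;> intro h' <;> linarith
    rw [key l rfl, key l' h.1.symm, h1 p]

theorem getD_eq_linForm (j : ℕ) (l : List ℝ) :
    l.getD j 0 = linForm (fun i => if i = j then 1 else 0) l := by
  simp only [linForm, Int.cast_ite, Int.cast_one, Int.cast_zero, ite_mul, one_mul, zero_mul,
    Finset.sum_ite_eq', Finset.mem_range]
  split_ifs with h
  · rfl
  · exact List.getD_eq_default _ _ (not_lt.1 h)

/-- The value of a term is a linear form whose coefficients are bounded by its Gödel number. -/
theorem exists_termVal_eq_linForm (n c : ℕ) :
    ∃ a : ℕ → ℤ, (∀ i, 0 ≤ a i ∧ a i ≤ c + 1) ∧ ∀ l : List ℝ, termVal n l c = linForm a l := by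
  have hvar : ∀ j : ℕ, ∃ a : ℕ → ℤ, (∀ i, 0 ≤ a i ∧ a i ≤ c + 1) ∧
      ∀ l : List ℝ, l.getD j 0 = linForm a l := fun j =>
    ⟨_, fun i => by split_ifs <;> omega, getD_eq_linForm j⟩
  have hzero : ∃ a : ℕ → ℤ, (∀ i, 0 ≤ a i ∧ a i ≤ c + 1) ∧
      ∀ l : List ℝ, (0 : ℝ) = linForm a l :=
    ⟨fun _ => 0, fun i => by dsimp only; omega, fun l => by simp [linForm]⟩
  induction c using Nat.strong_induction_on with
  | _ c ih =>
    have ih' : ∀ m < c, ∃ a : ℕ → ℤ, (∀ i, 0 ≤ a i ∧ a i ≤ m + 1) ∧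
        ∀ l : List ℝ, termVal n l m = linForm a l := fun m hm => ih m hm
      (fun j => ⟨_, fun i => by split_ifs <;> omega, getD_eq_linForm j⟩)
      ⟨fun _ => 0, fun i => by dsimp only; omega, fun l => by simp [linForm]⟩
    simp only [termVal.eq_def n _ c]
    split_ifs with h0 h1 h2 h3 h4
    · exact hvar _
    · exact hvar _
    · exact hzero
    · exact hvar _
    · obtain ⟨a, ha, ha'⟩ := ih' _ (unpair_snd_unpair_fst_lt h0)
      obtain ⟨b, hb, hb'⟩ := ih' _ (unpair_snd_unpair_snd_lt h0)
      refine ⟨fun i => 1 * a i - (-1) * b i, fun i => ?_, fun l => ?_⟩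
      · have h1 := Nat.add_le_pair c.unpair.1 c.unpair.2
        have h2 := Nat.add_le_pair c.unpair.2.unpair.1 c.unpair.2.unpair.2
        rw [Nat.pair_unpair] at h1 h2
        have := ha i
        have := hb i
        dsimp only
        omega
      · rw [linForm_sub, ha', hb']
        simp
    · exact hzero

/-- A bound for the coefficients of the linear forms whose signs determine the truth of the
formula with Gödel number `c`. -/
def signBound (c : ℕ) : ℕ := 2 ^ 3 ^ c

theorem one_le_signBound (c : ℕ) : 1 ≤ signBound c := Nat.one_le_two_pow

theorem le_signBound (c : ℕ) : c ≤ signBound c :=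
  ((Nat.lt_pow_self (by norm_num : 1 < 3)).trans (Nat.lt_pow_self (by norm_num : 1 < 2))).le

theorem signBound_mono {c c' : ℕ} (h : c ≤ c') : signBound c ≤ signBound c' :=
  Nat.pow_le_pow_right (by norm_num) (Nat.pow_le_pow_right (by norm_num) h)

theorem two_mul_signBound_sq_le {c c' : ℕ} (h : c < c') :
    2 * signBound c ^ 2 ≤ signBound c' := by
  refine le_trans ?_ (signBound_mono (Nat.succ_le_of_lt h))
  rw [signBound, signBound, ← pow_mul, ← pow_succ']
  refine Nat.pow_le_pow_right (by norm_num) ?_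
  have : 1 ≤ 3 ^ c := Nat.one_le_pow _ _ (by norm_num)
  rw [Nat.succ_eq_add_one, pow_succ]
  omega

theorem SameSigns.termVal_lt_iff {n s t B : ℕ} {l l' : List ℝ} (h : SameSigns B l l')
    (hs : s < B) (ht : t < B) :
    termVal n l s < termVal n l t ↔ termVal n l' s < termVal n l' t := by
  obtain ⟨a, ha, ha'⟩ := exists_termVal_eq_linForm n s
  obtain ⟨b, hb, hb'⟩ := exists_termVal_eq_linForm n t
  have key : ∀ m : List ℝ,
      termVal n m s < termVal n m t ↔ 0 < linForm (fun i => 1 * b i - 1 * a i) m := by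
    intro m
    rw [linForm_sub, ha', hb']
    simp
  rw [key, key]
  refine h.2 _ fun i => abs_le.2 ?_
  have := ha i
  have := hb i
  constructor <;> omega

/-- The truth of a formula depends only on the signs of the linear forms of bounded
coefficients. -/
theorem SameSigns.codeSat_iff {n c : ℕ} {l l' : List ℝ} (h : SameSigns (signBound c) l l') :
    codeSat n c l ↔ codeSat n c l' := by
  induction c using Nat.strong_induction_on generalizing l l' with
  | _ c ih =>
    have hlt : ∀ {a}, a < c → a < signBound c := fun ha => ha.trans_le (le_signBound c)
    rw [codeSat.eq_def n c l, codeSat.eq_def n c l']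
    split_ifs with h1 h2 h3 h4
    · have e1 := hlt (unpair_snd_unpair_fst_lt (c := c) (by omega))
      have e2 := hlt (unpair_snd_unpair_snd_lt (c := c) (by omega))
      rw [eq_iff_le_not_lt, eq_iff_le_not_lt, ← not_lt, ← not_lt,
        h.termVal_lt_iff e1 e2, h.termVal_lt_iff e2 e1]
    · exact h.termVal_lt_iff (hlt (unpair_snd_unpair_fst_lt (c := c) (by omega)))
        (hlt (unpair_snd_unpair_snd_lt (c := c) (by omega)))
    · have e1 := unpair_snd_unpair_fst_lt (c := c) (by omega)
      have e2 := unpair_snd_unpair_snd_lt (c := c) (by omega)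
      exact imp_congr (ih _ e1 (h.mono (signBound_mono e1.le)))
        (ih _ e2 (h.mono (signBound_mono e2.le)))
    · have e := unpair_snd_lt (c := c) (by omega)
      have h' := h.mono (two_mul_signBound_sq_le e)
      constructor
      · intro hx x
        obtain ⟨x', hx', -⟩ := h'.symm.exists_append (one_le_signBound _) x
        exact (ih _ e hx').2 (hx x')
      · intro hx x
        obtain ⟨x', hx', -⟩ := h'.exists_append (one_le_signBound _) x
        exact (ih _ e hx').2 (hx x')
    · exact Iff.rfl

/-! ### Quantifiers over the reals reduce to finite ranges of integers -/

/-- Integers are represented as differences of natural numbers. -/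
def diffHom : ℕ × ℕ →+ ℝ where
  toFun p := (p.1 : ℝ) - p.2
  map_zero' := by simp
  map_add' p q := by
    push_cast [Prod.fst_add, Prod.snd_add]
    ring

theorem diffHom_apply (p : ℕ × ℕ) : diffHom p = (p.1 : ℝ) - p.2 := rfl

/-- The real environment given by an environment of integers. -/
def diffEnv (L : List (ℕ × ℕ)) : List ℝ := L.map diffHom

/-- A bound for the sum of the absolute values of the entries of an environment of integers. -/
def envSize (L : List (ℕ × ℕ)) : ℕ := (L.map fun p => p.1 + p.2).sum

theorem exists_linForm_eq_int {B : ℕ} {c : ℕ → ℤ} (hc : ∀ i, |c i| ≤ B) (L : List (ℕ × ℕ)) :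
    ∃ z : ℤ, linForm c (diffEnv L) = z ∧ |z| ≤ B * envSize L := by
  induction L using List.reverseRecOn with
  | nil => exact ⟨0, by simp [linForm, diffEnv], by simp [envSize]⟩
  | append_singleton L p ih =>
    obtain ⟨z, hz, hz'⟩ := ih
    refine ⟨z + c (diffEnv L).length * (p.1 - p.2), ?_, ?_⟩
    · rw [diffEnv, List.map_append, List.map_singleton, linForm_append, ← diffEnv, hz,
        diffHom_apply]
      push_cast
      ring
    · have h1 : envSize (L ++ [p]) = envSize L + (p.1 + p.2) := by simp [envSize]
      have h2 : |((p.1 : ℤ) - p.2)| ≤ p.1 + p.2 := abs_le.2 ⟨by omega, by omega⟩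
      have h3 := mul_le_mul (hc (diffEnv L).length) h2 (abs_nonneg _) (by positivity)
      rw [← abs_mul] at h3
      rw [h1]
      push_cast
      linarith [abs_add_le z (c (diffEnv L).length * (p.1 - p.2))]

/-- The factor by which an environment is scaled before the quantifier in front of a formula
with Gödel number `c` is restricted to integers. It makes the midpoints of the relevant
thresholds integral. -/
def scaleFactor (c : ℕ) : ℕ := 2 * (signBound c).factorial

/-- The range of the integers to which a quantifier can be restricted. -/
def searchBound (c : ℕ) (L : List (ℕ × ℕ)) : ℕ :=
  scaleFactor c * (signBound c * envSize L) + 1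

/-- Scaling of an environment of integers. -/
def scaleEnv (s : ℕ) (L : List (ℕ × ℕ)) : List (ℕ × ℕ) := L.map fun p => (s * p.1, s * p.2)

theorem diffEnv_scaleEnv (s : ℕ) (L : List (ℕ × ℕ)) :
    diffEnv (scaleEnv s L) = (diffEnv L).map ((s : ℝ) * ·) := by
  simp only [diffEnv, scaleEnv, List.map_map]
  refine List.map_congr_left fun p _ => ?_
  simp only [Function.comp, diffHom_apply]
  push_cast
  ring

theorem exists_threshold_eq_int (c : ℕ) (L : List (ℕ × ℕ)) {r : ℕ}
    (p : ThresholdIndex (signBound c) r) :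
    ∃ w : ℤ, threshold (diffEnv (scaleEnv (scaleFactor c) L)) p = 2 * w ∧
      |2 * w| ≤ scaleFactor c * (signBound c * envSize L) := by
  obtain ⟨z, hz, hz'⟩ := exists_linForm_eq_int p.abs_coeff_le L
  obtain ⟨d, hd⟩ := Nat.dvd_factorial (Nat.succ_pos p.1) p.1.2
  have hpos : (0 : ℝ) < ((p.1 : ℕ) + 1 : ℕ) := by positivity
  have hdle : d ≤ (signBound c).factorial := by
    rw [hd]; exact Nat.le_mul_of_pos_left _ (Nat.succ_pos _)
  refine ⟨-(d * z), ?_, ?_⟩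
  · rw [threshold, diffEnv_scaleEnv, linForm_smul, hz, scaleFactor, hd, div_eq_iff hpos.ne']
    push_cast
    ring
  · rw [abs_mul, abs_neg, abs_mul, abs_two, Nat.abs_cast, scaleFactor]
    push_cast
    have h1 : ((d : ℤ)) * |z| ≤ (signBound c).factorial * (signBound c * envSize L) :=
      mul_le_mul (by exact_mod_cast hdle) hz' (abs_nonneg _) (by positivity)
    linarith

/-- Over an environment of integers, a universal quantifier may be restricted to a finite range
of integers, after scaling. -/
theorem codeSat_forall_iff (n c : ℕ) (L : List (ℕ × ℕ)) :
    (∀ x : ℝ, codeSat n c (diffEnv L ++ [x])) ↔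
      ∀ i < (searchBound c L + 1) ^ 2,
        codeSat n c (diffEnv (scaleEnv (scaleFactor c) L ++ [i.unpair])) := by
  have hs : (0 : ℝ) < (scaleFactor c : ℕ) := by
    exact_mod_cast Nat.mul_pos two_pos (Nat.factorial_pos _)
  have scale : ∀ x : ℝ, codeSat n c (diffEnv L ++ [x]) ↔
      codeSat n c (diffEnv (scaleEnv (scaleFactor c) L) ++ [scaleFactor c * x]) := by
    intro x
    have := (SameSigns.smul (signBound c) (diffEnv L ++ [x]) hs).codeSat_iff (n := n)
    rwa [List.map_append, ← diffEnv_scaleEnv] at this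
  have happ : ∀ i : ℕ, diffEnv (scaleEnv (scaleFactor c) L ++ [i.unpair]) =
      diffEnv (scaleEnv (scaleFactor c) L) ++ [diffHom i.unpair] := fun i => by
    simp [diffEnv]
  constructor
  · intro h i _
    have := (scale (diffHom i.unpair / scaleFactor c)).1 (h _)
    rwa [mul_div_cancel₀ _ hs.ne', ← happ] at this
  · intro h x
    rw [scale]
    obtain ⟨x', hx', p, q, hpq⟩ :=
      (SameSigns.refl (2 * signBound c ^ 2)
        (diffEnv (scaleEnv (scaleFactor c) L))).exists_append (one_le_signBound c)
        (scaleFactor c * x)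
    rw [hx'.codeSat_iff]
    have hint : ∃ z : ℤ, x' = z ∧ |z| ≤ searchBound c L := by
      obtain ⟨w, hw, hw'⟩ := exists_threshold_eq_int c L p
      obtain ⟨u, hu, hu'⟩ := exists_threshold_eq_int c L q
      rw [abs_le] at hw' hu'
      simp only [searchBound, abs_le]
      push_cast
      rcases hpq with h | h | h
      · exact ⟨w + u, by rw [h, hw, hu]; push_cast; ring, by constructor <;> linarith⟩
      · exact ⟨2 * w + 1, by rw [h, hw]; push_cast; ring, by constructor <;> linarith⟩
      · exact ⟨2 * w - 1, by rw [h, hw]; push_cast; ring, by constructor <;> linarith⟩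
    obtain ⟨z, rfl, hz⟩ := hint
    have hz' := abs_le.1 hz
    have := h (Nat.pair z.toNat (-z).toNat) (lt_of_lt_of_le (Nat.pair_lt_max_add_one_sq _ _)
      (Nat.pow_le_pow_left (by omega) 2))
    rw [happ, Nat.unpair_pair, diffHom_apply] at this
    convert this using 3
    dsimp only
    exact_mod_cast (by omega : z = (z.toNat : ℤ) - ((-z).toNat : ℤ))

/-! ### A decision procedure for `⟨ℝ, <, +, 0, 1⟩` -/

theorem primrec_pow {α : Type} [Primcodable α] {f g : α → ℕ} (hf : Primrec f) (hg : Primrec g) :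
    Primrec fun a => f a ^ g a :=
  (Primrec.nat_rec' hg (.const 1) (Primrec.nat_mul.comp (Primrec.snd.comp Primrec.snd)
    (hf.comp Primrec.fst)).to₂).of_eq fun a => by
      induction g a with
      | zero => rfl
      | succ k ih => rw [pow_succ, ← ih]

theorem primrec_factorial : Primrec Nat.factorial :=
  (Primrec.nat_rec₁ 1 (Primrec.nat_mul.comp (Primrec.succ.comp Primrec.fst)
    Primrec.snd).to₂).of_eq fun k => by
      induction k with
      | zero => rfl
      | succ k ih => rw [Nat.factorial_succ, ← ih]

theorem primrec_scaleFactor : Primrec scaleFactor :=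
  Primrec.nat_mul.comp (.const 2) (primrec_factorial.comp
    (primrec_pow (.const 2) (primrec_pow (.const 3) .id)))

theorem primrec_signBound : Primrec signBound :=
  primrec_pow (.const 2) (primrec_pow (.const 3) .id)

theorem primrec_envSize : Primrec envSize :=
  (Primrec.list_foldr Primrec.id (.const 0)
    (Primrec.nat_add.comp (Primrec.nat_add.comp
      (Primrec.fst.comp (Primrec.fst.comp Primrec.snd))
      (Primrec.snd.comp (Primrec.fst.comp Primrec.snd)))
      (Primrec.snd.comp Primrec.snd)).to₂).of_eq fun L => by
        simp [envSize, List.sum, List.foldr_map]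

theorem primrec_scaleEnv : Primrec₂ scaleEnv :=
  Primrec.list_map Primrec.snd (Primrec.pair
    (Primrec.nat_mul.comp (Primrec.fst.comp Primrec.fst) (Primrec.fst.comp Primrec.snd))
    (Primrec.nat_mul.comp (Primrec.fst.comp Primrec.fst) (Primrec.snd.comp Primrec.snd))).to₂

theorem primrec_searchBound : Primrec₂ searchBound :=
  (Primrec.succ.comp (Primrec.nat_mul.comp (primrec_scaleFactor.comp Primrec.fst)
    (Primrec.nat_mul.comp (primrec_signBound.comp Primrec.fst)
      (primrec_envSize.comp Primrec.snd)))).to₂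

/-- Evaluation nodes: the number of free variables, a Gödel number, and an environment of
integers. -/
abbrev EvalNode : Type := ℕ × ℕ × List (ℕ × ℕ)

theorem primrec_tagEq {α : Type} [Primcodable α] {f : α → ℕ} (hf : Primrec f) (t : ℕ) :
    PrimrecPred fun a => (f a).unpair.1 = t :=
  Primrec.eq.comp (Primrec.fst.comp (Primrec.unpair.comp hf)) (.const t)

theorem primrec_body {α : Type} [Primcodable α] {f : α → ℕ} (hf : Primrec f) :
    Primrec fun a => (f a).unpair.2 :=
  Primrec.snd.comp (Primrec.unpair.comp hf)

theorem primrec_bodyFst {α : Type} [Primcodable α] {f : α → ℕ} (hf : Primrec f) :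
    Primrec fun a => (f a).unpair.2.unpair.1 :=
  Primrec.fst.comp (Primrec.unpair.comp (primrec_body hf))

theorem primrec_bodySnd {α : Type} [Primcodable α] {f : α → ℕ} (hf : Primrec f) :
    Primrec fun a => (f a).unpair.2.unpair.2 :=
  Primrec.snd.comp (Primrec.unpair.comp (primrec_body hf))

theorem primrec_termVal : Primrec fun b : EvalNode => termVal b.1 b.2.2 b.2.1 := by
  have hn : Primrec fun b : EvalNode => b.1 := Primrec.fst
  have hc : Primrec fun b : EvalNode => b.2.1 := Primrec.fst.comp Primrec.snd
  have hL : Primrec fun b : EvalNode => b.2.2 := Primrec.snd.comp Primrec.snd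
  have hget : ∀ {f : EvalNode → ℕ}, Primrec f →
      Primrec fun b : EvalNode => b.2.2.getD (f b) 0 :=
    fun hf => (Primrec.list_getD 0).comp hL hf
  have hi : ∀ j : ℕ, Primrec fun p : EvalNode × List (ℕ × ℕ) => p.2.getD j 0 := fun j =>
    (Primrec.list_getD 0).comp Primrec.snd (.const j)
  refine Primrec.nat_omega_rec' _ (m := fun b => b.2.1)
    (l := fun b => if b.2.1.unpair.1 = 4 then
      [(b.1, b.2.1.unpair.2.unpair.1, b.2.2), (b.1, b.2.1.unpair.2.unpair.2, b.2.2)] else [])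
    (g := fun b rs => some (
      if b.2.1.unpair.1 = 0 then b.2.2.getD (1 + b.2.1.unpair.2) 0
      else if b.2.1.unpair.1 = 1 then b.2.2.getD (1 + b.1 + b.2.1.unpair.2) 0
      else if b.2.1.unpair.1 = 2 then 0
      else if b.2.1.unpair.1 = 3 then b.2.2.getD 0 0
      else if b.2.1.unpair.1 = 4 then
        ((rs.getD 0 0).1 + (rs.getD 1 0).1, (rs.getD 0 0).2 + (rs.getD 1 0).2)
      else 0)) hc ?_ ?_ ?_ ?_
  · exact Primrec.ite (primrec_tagEq hc 4)
      (Primrec.list_cons.comp (hn.pair ((primrec_bodyFst hc).pair hL))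
        (Primrec.list_cons.comp (hn.pair ((primrec_bodySnd hc).pair hL)) (.const [])))
      (.const [])
  · have hc' := hc.comp (Primrec.fst (α := EvalNode) (β := List (ℕ × ℕ)))
    exact Primrec.option_some.comp₂ (
      Primrec.ite (primrec_tagEq hc' 0)
        ((hget (Primrec.nat_add.comp (.const 1) (primrec_body hc))).comp Primrec.fst) <|
      Primrec.ite (primrec_tagEq hc' 1)
        ((hget (Primrec.nat_add.comp (Primrec.nat_add.comp (.const 1) hn)
          (primrec_body hc))).comp Primrec.fst) <|
      Primrec.ite (primrec_tagEq hc' 2) (.const (0 : ℕ × ℕ)) <|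
      Primrec.ite (primrec_tagEq hc' 3) ((hget (.const 0)).comp Primrec.fst) <|
      Primrec.ite (primrec_tagEq hc' 4) (Primrec.pair
        (Primrec.nat_add.comp (Primrec.fst.comp (hi 0)) (Primrec.fst.comp (hi 1)))
        (Primrec.nat_add.comp (Primrec.snd.comp (hi 0)) (Primrec.snd.comp (hi 1))))
        (.const (0 : ℕ × ℕ))).to₂
  · intro b b' hb'
    split_ifs at hb' with h4
    · simp only [List.mem_cons, List.not_mem_nil, or_false] at hb'
      rcases hb' with rfl | rfl
      · exact unpair_snd_unpair_fst_lt (by omega)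
      · exact unpair_snd_unpair_snd_lt (by omega)
    · simp at hb'
  · intro b
    rw [termVal.eq_def b.1 b.2.2 b.2.1]
    split_ifs with h0 h1 h2 h3 h4 <;> rfl

theorem diffHom_lt_iff (p q : ℕ × ℕ) : diffHom p < diffHom q ↔ p.1 + q.2 < q.1 + p.2 := by
  rw [diffHom_apply, diffHom_apply, sub_lt_sub_iff]
  exact_mod_cast Iff.rfl

theorem diffHom_eq_iff (p q : ℕ × ℕ) : diffHom p = diffHom q ↔ p.1 + q.2 = q.1 + p.2 := by
  rw [diffHom_apply, diffHom_apply, sub_eq_sub_iff_add_eq_add]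
  exact_mod_cast Iff.rfl

/-- Over environments of integers, the truth of formulas of `⟨ℝ, <, +, 0, 1⟩` is decided by a
primitive recursive function. -/
theorem exists_primrec_codeSat :
    ∃ f : EvalNode → Bool, Primrec f ∧
      ∀ n c L, f (n, c, L) = true ↔ codeSat n c (diffEnv L) := by
  have hn : Primrec fun b : EvalNode => b.1 := Primrec.fst
  have hc : Primrec fun b : EvalNode => b.2.1 := Primrec.fst.comp Primrec.snd
  have hL : Primrec fun b : EvalNode => b.2.2 := Primrec.snd.comp Primrec.snd
  have hb : Primrec fun b : EvalNode => b.2.1.unpair.2 := primrec_body hc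
  have hr : ∀ j : ℕ, Primrec fun p : EvalNode × List Bool => p.2.getD j false := fun j =>
    (Primrec.list_getD false).comp Primrec.snd (.const j)
  have ht : ∀ {f : EvalNode → ℕ}, Primrec f →
      Primrec fun b : EvalNode => termVal b.1 b.2.2 (f b) :=
    fun hf => primrec_termVal.comp (hn.pair (hf.pair hL))
  have hs := ht (primrec_bodyFst hc)
  have ht := ht (primrec_bodySnd hc)
  have e1 := Primrec.nat_add.comp (Primrec.fst.comp hs) (Primrec.snd.comp ht)
  have e2 := Primrec.nat_add.comp (Primrec.fst.comp ht) (Primrec.snd.comp hs)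
  obtain ⟨f, hf, hf'⟩ := exists_primrec_treeRec (β := EvalNode) (σ := Bool)
    (m := fun b => b.2.1)
    (l := fun b =>
      if b.2.1.unpair.1 = 3 then
        [(b.1, b.2.1.unpair.2.unpair.1, b.2.2), (b.1, b.2.1.unpair.2.unpair.2, b.2.2)]
      else if b.2.1.unpair.1 = 4 then
        (List.range ((searchBound b.2.1.unpair.2 b.2.2 + 1) ^ 2)).map fun i =>
          (b.1, b.2.1.unpair.2, scaleEnv (scaleFactor b.2.1.unpair.2) b.2.2 ++ [i.unpair])
      else [])
    (g := fun b rs =>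
      if b.2.1.unpair.1 = 1 then
        decide ((termVal b.1 b.2.2 b.2.1.unpair.2.unpair.1).1 +
            (termVal b.1 b.2.2 b.2.1.unpair.2.unpair.2).2 =
          (termVal b.1 b.2.2 b.2.1.unpair.2.unpair.2).1 +
            (termVal b.1 b.2.2 b.2.1.unpair.2.unpair.1).2)
      else if b.2.1.unpair.1 = 2 then
        decide ((termVal b.1 b.2.2 b.2.1.unpair.2.unpair.1).1 +
            (termVal b.1 b.2.2 b.2.1.unpair.2.unpair.2).2 <
          (termVal b.1 b.2.2 b.2.1.unpair.2.unpair.2).1 +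
            (termVal b.1 b.2.2 b.2.1.unpair.2.unpair.1).2)
      else if b.2.1.unpair.1 = 3 then !(rs.getD 0 false) || rs.getD 1 false
      else if b.2.1.unpair.1 = 4 then rs.foldr (fun r s => r && s) true
      else false) hc
    (Primrec.ite (primrec_tagEq hc 3)
      (Primrec.list_cons.comp (hn.pair ((primrec_bodyFst hc).pair hL))
        (Primrec.list_cons.comp (hn.pair ((primrec_bodySnd hc).pair hL)) (.const []))) <|
      Primrec.ite (primrec_tagEq hc 4)
        (Primrec.list_map
          (Primrec.list_range.comp
            (primrec_pow (Primrec.succ.comp (primrec_searchBound.comp hb hL)) (.const 2)))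
          ((hn.comp Primrec.fst).pair ((hb.comp Primrec.fst).pair
            (Primrec.list_append.comp
              ((primrec_scaleEnv.comp (primrec_scaleFactor.comp hb) hL).comp Primrec.fst)
              (Primrec.list_cons.comp (Primrec.unpair.comp Primrec.snd) (.const []))))).to₂)
        (.const []))
    (Primrec.ite (primrec_tagEq (hc.comp Primrec.fst) 1)
        ((Primrec.eq.comp e1 e2).decide.comp Primrec.fst) <|
      Primrec.ite (primrec_tagEq (hc.comp Primrec.fst) 2)
        ((Primrec.nat_lt.comp e1 e2).decide.comp Primrec.fst) <|
      Primrec.ite (primrec_tagEq (hc.comp Primrec.fst) 3)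
        (Primrec.or.comp (Primrec.not.comp (hr 0)) (hr 1)) <|
      Primrec.ite (primrec_tagEq (hc.comp Primrec.fst) 4)
        (Primrec.list_foldr Primrec.snd (.const true)
          (Primrec.and.comp (Primrec.fst.comp Primrec.snd) (Primrec.snd.comp Primrec.snd)).to₂)
        (.const false)).to₂
    (fun b b' hb' => by
      split_ifs at hb' with h3 h4
      · simp only [List.mem_cons, List.not_mem_nil, or_false] at hb'
        rcases hb' with rfl | rfl
        · exact unpair_snd_unpair_fst_lt (by omega)
        · exact unpair_snd_unpair_snd_lt (by omega)
      · obtain ⟨i, -, rfl⟩ := List.mem_map.1 hb'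
        exact unpair_snd_lt (by omega)
      · simp at hb')
  refine ⟨f, hf, fun n c L => ?_⟩
  induction c using Nat.strong_induction_on generalizing L with
  | _ c ih =>
    have hand : ∀ rs : List Bool,
        rs.foldr (fun r s => r && s) true = true ↔ ∀ r ∈ rs, r = true := fun rs => by
      induction rs with
      | nil => simp
      | cons r rs ih => simp [ih]
    rw [hf', codeSat]
    dsimp only
    simp only [diffEnv, termVal_map, diffHom_lt_iff, diffHom_eq_iff]
    split_ifs with h1 h2 h3 h4
    · rw [decide_eq_true_iff]
    · rw [decide_eq_true_iff]
    · rw [← diffEnv, ← ih _ (unpair_snd_unpair_fst_lt (by omega)),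
        ← ih _ (unpair_snd_unpair_snd_lt (by omega))]
      simp only [List.map_cons, List.getD_cons_zero, List.getD_cons_succ]
      cases f (n, c.unpair.2.unpair.1, L) <;> simp
    · rw [← diffEnv, codeSat_forall_iff, hand]
      simp only [List.map_map, List.mem_map, List.mem_range, Function.comp, forall_exists_index,
        and_imp, forall_apply_eq_imp_iff₂]
      exact forall₂_congr fun i _ => ih _ (unpair_snd_lt (by omega)) _
    · simp

/-! ### Attractors of timed games -/

/-- The clock valuation reached by letting time `τ` pass. -/
def delayed {n : ℕ} (y : Fin n → ℝ) (τ : ℝ) : Fin n → ℝ := fun i => y i + τ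

/-- The clock valuation after a transition. -/
def TimedEdge.resetAt {n m k : ℕ} (e : TimedEdge n m k) (y : Fin n → ℝ) : Fin n → ℝ :=
  fun i => if i ∈ e.reset then 0 else y i

/-- The states from which the controller can, with one move `(τ, a)`, force the next state of the
play to lie in `W`: all transitions labelled `a` after the delay `τ`, and all uncontrollable
transitions after a delay of at most `τ`, lead to `W`. The action `a` is given by a transition
`e₀` that it enables. -/
def TimedGame.cpre (A : TimedGame) (W : Set (Fin A.locs × (Fin A.clocks → ℝ))) :
    Set (Fin A.locs × (Fin A.clocks → ℝ)) :=
  {s | ∃ τ, 0 ≤ τ ∧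
    (∃ e₀ ∈ A.edges, e₀.src = s.1 ∧ e₀.act ∈ A.ctrl ∧ e₀.guard.Sat (delayed s.2 τ) ∧
      ∀ e ∈ A.edges, e.src = s.1 → e.act = e₀.act → e.guard.Sat (delayed s.2 τ) →
        (e.tgt, e.resetAt (delayed s.2 τ)) ∈ W) ∧
    ∀ σ, 0 ≤ σ → σ ≤ τ → ∀ e ∈ A.edges, e.src = s.1 → e.act ∉ A.ctrl →
      e.guard.Sat (delayed s.2 σ) → (e.tgt, e.resetAt (delayed s.2 σ)) ∈ W}

/-- The states from which the controller can force a visit to a goal location within `i` moves. -/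
def TimedGame.attractor (A : TimedGame) : ℕ → Set (Fin A.locs × (Fin A.clocks → ℝ))
  | 0 => {s | s.1 ∈ A.goal}
  | i + 1 => {s | s.1 ∈ A.goal} ∪ A.cpre (A.attractor i)

theorem TimedGame.cpre_mono (A : TimedGame) {W W' : Set (Fin A.locs × (Fin A.clocks → ℝ))}
    (h : W ⊆ W') : A.cpre W ⊆ A.cpre W' := by
  rintro s ⟨τ, hτ, ⟨e₀, h₀, h1, h2, h3, h4⟩, h5⟩
  exact ⟨τ, hτ, ⟨e₀, h₀, h1, h2, h3, fun e he h6 h7 h8 => h (h4 e he h6 h7 h8)⟩,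
    fun σ hσ hστ e he h6 h7 h8 => h (h5 σ hσ hστ e he h6 h7 h8)⟩

theorem TimedGame.attractor_mono (A : TimedGame) : Monotone A.attractor := by
  refine monotone_nat_of_le_succ fun i => ?_
  induction i with
  | zero => exact Set.subset_union_left
  | succ i ih => exact Set.union_subset_union_right _ (A.cpre_mono ih)

theorem TimedGame.goal_subset_attractor (A : TimedGame) (i : ℕ) {s} (h : s.1 ∈ A.goal) :
    s ∈ A.attractor i := by
  cases i with
  | zero => exact h
  | succ i => exact Or.inl h

theorem delayed_mem {n : ℕ} {y : Fin n → ℝ} (hy : y ∈ clockValuations n) {τ : ℝ} (hτ : 0 ≤ τ) :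
    delayed y τ ∈ clockValuations n := fun i => add_nonneg (hy i) hτ

theorem TimedEdge.resetAt_mem {n m k : ℕ} (e : TimedEdge n m k) {y : Fin n → ℝ}
    (hy : y ∈ clockValuations n) : e.resetAt y ∈ clockValuations n := by
  intro i
  unfold resetAt
  split_ifs
  · exact le_rfl
  · exact hy i

/-! ### Runs of games -/

section runs

variable {G : HybridGame}

theorem winning_nil_iff (c : G.Config) : (HybridGame.FinRun.nil c).Winning ↔ c.loc ∈ G.goal := by
  rw [HybridGame.FinRun.Winning]

theorem winning_snoc_iff {c d : G.Config} (ρ : G.FinRun c d) (τ : ℝ) (a : G.Act) (e : G.Config)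
    (h : G.Step τ a d e) : (ρ.snoc τ a e h).Winning ↔ ρ.Winning ∨ e.loc ∈ G.goal := by
  rw [HybridGame.FinRun.Winning]

theorem consistent_nil (s : G.Strategy) (c : G.Config) :
    (HybridGame.FinRun.nil c).Consistent s := by
  rw [HybridGame.FinRun.Consistent]
  trivial

theorem consistent_snoc_iff (s : G.Strategy) {c d : G.Config} (ρ : G.FinRun c d) (τ : ℝ)
    (a : G.Act) (e : G.Config) (h : G.Step τ a d e) :
    (ρ.snoc τ a e h).Consistent s ↔ ρ.Consistent s ∧ s.Allows ρ τ a := by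
  rw [HybridGame.FinRun.Consistent]

theorem winning_of_last {c d : G.Config} (ρ : G.FinRun c d) (h : d.loc ∈ G.goal) :
    ρ.Winning := by
  cases ρ with
  | nil => exact (winning_nil_iff c).2 h
  | snoc ρ τ a e hs => exact (winning_snoc_iff ρ τ a d hs).2 (Or.inr h)

end runs

/-! ### Strategies and attractors -/

section strategies

variable {A : TimedGame}

/-- The state `(q, y)` of a configuration `(q, x, t, y)`. -/
def configState (c : A.toHybrid.Config) : Fin A.locs × (Fin A.clocks → ℝ) := (c.loc, c.pos)

theorem configState_snd_mem (c : A.toHybrid.Config) :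
    (configState c).2 ∈ clockValuations A.clocks :=
  A.toHybrid.dyn_mem c.loc c.x c.x_mem c.t c.t_mem

theorem exists_config (q : Fin A.locs) {y : Fin A.clocks → ℝ} (hy : y ∈ clockValuations A.clocks) :
    ∃ c : A.toHybrid.Config, configState c = (q, y) := by
  refine ⟨⟨q, y, 0, hy, le_refl (0 : ℝ)⟩, ?_⟩
  refine Prod.ext rfl (funext fun i => ?_)
  exact add_zero (y i)

theorem step_iff {τ : ℝ} {a : Fin A.acts} {c c' : A.toHybrid.Config} :
    A.toHybrid.Step τ a c c' ↔ 0 ≤ τ ∧ ∃ e ∈ A.edges, e.src = (configState c).1 ∧ e.act = a ∧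
      e.guard.Sat (delayed (configState c).2 τ) ∧
      configState c' = (e.tgt, e.resetAt (delayed (configState c).2 τ)) := by
  have hpos : ∀ d : A.toHybrid.Config, d.x = c.x → d.t = c.t + τ →
      d.pos = delayed (configState c).2 τ := by
    intro d hx ht
    funext i
    change d.x i + d.t = (c.x i + c.t) + τ
    rw [hx, ht, add_assoc]
  constructor
  · rintro ⟨d, ⟨hτ, hloc, hx, ht⟩, e, ⟨e', he', rfl⟩, hsrc, hact, htgt, hguard, hreset⟩
    have hd := hpos d hx ht
    rw [hd] at hguard hreset
    exact ⟨hτ, e', he', hsrc.trans hloc, hact, hguard.2, Prod.ext htgt.symm hreset⟩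
  · rintro ⟨hτ, e, he, hsrc, hact, hguard, hc'⟩
    let d : A.toHybrid.Config := ⟨c.loc, c.x, c.t + τ, c.x_mem, add_nonneg c.t_mem hτ⟩
    have hd := hpos d rfl rfl
    refine ⟨d, ⟨hτ, rfl, rfl, rfl⟩, e.toHybrid, ⟨e, he, rfl⟩, hsrc, hact,
      (congrArg Prod.fst hc').symm, ?_, ?_⟩
    · rw [hd]
      exact ⟨delayed_mem (configState_snd_mem c) hτ, hguard⟩
    · rw [hd]
      exact congrArg Prod.snd hc'

theorem exists_step {τ : ℝ} (hτ : 0 ≤ τ) {c : A.toHybrid.Config} {e} (he : e ∈ A.edges)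
    (hsrc : e.src = (configState c).1) (hguard : e.guard.Sat (delayed (configState c).2 τ)) :
    ∃ c' : A.toHybrid.Config, A.toHybrid.Step τ e.act c c' ∧
      configState c' = (e.tgt, e.resetAt (delayed (configState c).2 τ)) := by
  obtain ⟨c', hc'⟩ := exists_config e.tgt
    (e.resetAt_mem (delayed_mem (configState_snd_mem c) hτ))
  exact ⟨c', step_iff.2 ⟨hτ, e, he, hsrc, rfl, hguard, hc'⟩, hc'⟩

/-- Membership in `cpre` in terms of the steps of the game. -/
theorem mem_cpre_iff {c : A.toHybrid.Config} {W : Set (Fin A.locs × (Fin A.clocks → ℝ))} :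
    configState c ∈ A.cpre W ↔ ∃ (τ : ℝ) (a : Fin A.acts), a ∈ A.ctrl ∧
      A.toHybrid.Enabled τ a c ∧ ∀ (τ' : ℝ) (a' : Fin A.acts) (c' : A.toHybrid.Config),
        A.toHybrid.Step τ' a' c c' → (τ' = τ ∧ a' = a) ∨ (τ' ≤ τ ∧ a' ∉ A.ctrl) →
          configState c' ∈ W := by
  constructor
  · rintro ⟨τ, hτ, ⟨e₀, he₀, hsrc, hctrl, hguard, hW⟩, hW'⟩
    refine ⟨τ, e₀.act, hctrl, ?_, fun τ' a' c' hstep h => ?_⟩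
    · exact (exists_step hτ he₀ hsrc hguard).imp fun c' hc' => hc'.1
    · obtain ⟨hτ', e, he, hsrc', rfl, hguard', hc'⟩ := step_iff.1 hstep
      rw [hc']
      rcases h with ⟨rfl, ha⟩ | ⟨hle, ha⟩
      · exact hW e he hsrc' ha hguard'
      · exact hW' τ' hτ' hle e he hsrc' ha hguard'
  · rintro ⟨τ, a, hctrl, ⟨d, hd⟩, hW⟩
    obtain ⟨hτ, e₀, he₀, hsrc, rfl, hguard, -⟩ := step_iff.1 hd
    refine ⟨τ, hτ, ⟨e₀, he₀, hsrc, hctrl, hguard, fun e he hsrc' hact hguard' => ?_⟩,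
      fun σ hσ hστ e he hsrc' hact hguard' => ?_⟩
    · obtain ⟨c', hstep, hc'⟩ := exists_step hτ he hsrc' hguard'
      exact hc' ▸ hW τ e.act c' hstep (Or.inl ⟨rfl, hact⟩)
    · obtain ⟨c', hstep, hc'⟩ := exists_step hσ he hsrc' hguard'
      exact hc' ▸ hW σ e.act c' hstep (Or.inr ⟨hστ, hact⟩)

/-- `(τ, a)` is a good move in `c`: whatever consistent step follows, the play comes closer to
the goal, as measured by the attractors. -/
def GoodMove (c : A.toHybrid.Config) (p : ℝ × Fin A.acts) : Prop :=
  p.2 ∈ A.ctrl ∧ A.toHybrid.Enabled p.1 p.2 c ∧ ∀ i, configState c ∈ A.attractor (i + 1) →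
    ∀ (τ' : ℝ) (a' : Fin A.acts) (c' : A.toHybrid.Config), A.toHybrid.Step τ' a' c c' →
      (τ' = p.1 ∧ a' = p.2) ∨ (τ' ≤ p.1 ∧ a' ∉ A.ctrl) → configState c' ∈ A.attractor i

theorem exists_goodMove {c : A.toHybrid.Config} {i : ℕ} (hc : configState c ∈ A.attractor i)
    (hgoal : (configState c).1 ∉ A.goal) : ∃ p, GoodMove c p := by
  classical
  -- a move that is good for the least attractor containing the state is good for all
  have hex : ∃ i, configState c ∈ A.attractor i := ⟨i, hc⟩
  obtain ⟨j, hj⟩ : ∃ j, Nat.find hex = j + 1 := Nat.exists_eq_succ_of_ne_zero fun h0 => by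
    have := Nat.find_spec hex
    rw [h0] at this
    exact hgoal this
  have hmem := Nat.find_spec hex
  rw [hj] at hmem
  obtain ⟨τ, a, hctrl, hen, hW⟩ := mem_cpre_iff.1 (hmem.resolve_left hgoal)
  refine ⟨(τ, a), hctrl, hen, fun i hi τ' a' c' hstep h => ?_⟩
  have : j ≤ i := by
    have := Nat.find_min' hex hi
    omega
  exact A.attractor_mono this (hW τ' a' c' hstep h)

open Classical in
/-- The strategy that makes good moves as long as there are any and no goal is reached. -/
noncomputable def attractorStrategy (A : TimedGame) : A.toHybrid.Strategy where
  choice := fun {_ d} _ =>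
    if h : (configState d).1 ∉ A.goal ∧ ∃ p, GoodMove d p then some h.2.choose else none
  valid := by
    intro c d ρ τ a h
    split_ifs at h with h'
    have := h'.2.choose_spec
    rw [Option.some.inj h] at this
    exact ⟨this.1, this.2.1⟩

/-- A step allowed by the attractor strategy outside of the goal decreases the attractor. -/
theorem attractorStrategy_step {c d e : A.toHybrid.Config} (ρ : A.toHybrid.FinRun c d) {τ : ℝ}
    {a : Fin A.acts} (hs : A.toHybrid.Step τ a d e) (hall : (attractorStrategy A).Allows ρ τ a)
    {i : ℕ} (hd : configState d ∈ A.attractor i) (hgoal : (configState d).1 ∉ A.goal) :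
    ∃ j, i = j + 1 ∧ configState e ∈ A.attractor j := by
  have hex : ∃ p, GoodMove d p := exists_goodMove hd hgoal
  obtain ⟨j, rfl⟩ : ∃ j, i = j + 1 := Nat.exists_eq_succ_of_ne_zero fun h0 => by
    subst h0; exact hgoal hd
  have hch : (attractorStrategy A).choice ρ = some hex.choose := dif_pos ⟨hgoal, hex⟩
  exact ⟨j, rfl, hex.choose_spec.2.2 j hd τ a e hs (hall _ _ hch)⟩

theorem mem_winningStates_of_mem_attractor {q : Fin A.locs} {y : Fin A.clocks → ℝ} {i : ℕ}
    (hy : y ∈ clockValuations A.clocks) (h : (q, y) ∈ A.attractor i) :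
    (q, y) ∈ A.toHybrid.winningStates := by
  refine ⟨hy, attractorStrategy A, fun c hq hpos => ?_⟩
  have hc : configState c ∈ A.attractor i := by
    rwa [show configState c = (q, y) from Prod.ext hq hpos]
  constructor
  · intro d ρ hcons hnone
    have key : ∀ {c d : A.toHybrid.Config} (ρ : A.toHybrid.FinRun c d),
        configState c ∈ A.attractor i → ρ.Consistent (attractorStrategy A) →
          ρ.Winning ∨ ∃ j, configState d ∈ A.attractor j := by
      intro c d ρ hc
      induction ρ with
      | nil => exact fun _ => Or.inr ⟨i, hc⟩
      | @snoc d ρ τ a e hs ih =>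
        rw [consistent_snoc_iff, winning_snoc_iff]
        rintro ⟨hcons, hall⟩
        rcases ih hcons with hw | ⟨j, hj⟩
        · exact Or.inl (Or.inl hw)
        · by_cases hgoal : (configState d).1 ∈ A.goal
          · exact Or.inl (Or.inl (winning_of_last ρ hgoal))
          · obtain ⟨j', -, hj'⟩ := attractorStrategy_step ρ hs hall hj hgoal
            exact Or.inr ⟨j', hj'⟩
    rcases key ρ hc hcons with hw | ⟨j, hj⟩
    · exact hw
    · by_cases hgoal : (configState d).1 ∈ A.goal
      · exact winning_of_last ρ hgoal
      · have hch : (attractorStrategy A).choice ρ = some (exists_goodMove hj hgoal).choose :=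
          dif_pos ⟨hgoal, exists_goodMove hj hgoal⟩
        rw [hnone] at hch
        cases hch
  · intro r hr hcons
    have key : ∀ i k, configState (r.cfg k) ∈ A.attractor i → r.Winning := by
      intro i
      induction i with
      | zero => exact fun k hk => ⟨k, hk⟩
      | succ i ih =>
        intro k hk
        by_cases hgoal : (configState (r.cfg k)).1 ∈ A.goal
        · exact ⟨k, hgoal⟩
        · obtain ⟨j, hj, hj'⟩ :=
            attractorStrategy_step (r.prefixRun k) (r.step k) (hcons k) hk hgoal
          obtain rfl : i = j := by omega
          exact ih (k + 1) hj'
    exact key i 0 (hr ▸ hc)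

/-- A consistent finite run that has not visited a goal and has left the attractor `N`. -/
structure EscapingRun (s : A.toHybrid.Strategy) (N : ℕ) (c : A.toHybrid.Config) where
  last : A.toHybrid.Config
  run : A.toHybrid.FinRun c last
  consistent : run.Consistent s
  not_winning : ¬ run.Winning
  not_mem : configState last ∉ A.attractor N

/-- One more step of an escaping run. -/
structure EscapingStep {s : A.toHybrid.Strategy} {N : ℕ} {c : A.toHybrid.Config}
    (r : EscapingRun s N c) where
  delay : ℝ
  act : Fin A.acts
  next : A.toHybrid.Config
  step : A.toHybrid.Step delay act r.last next
  allows : s.Allows r.run delay act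
  not_mem : configState next ∉ A.attractor N

/-- The escaping run prolonged by one step. -/
def EscapingStep.extend {s : A.toHybrid.Strategy} {N : ℕ} {c : A.toHybrid.Config}
    {r : EscapingRun s N c} (e : EscapingStep r) : EscapingRun s N c where
  last := e.next
  run := .snoc r.run e.delay e.act e.next e.step
  consistent := (consistent_snoc_iff s _ _ _ _ _).2 ⟨r.consistent, e.allows⟩
  not_winning := fun h => ((winning_snoc_iff _ _ _ _ _).1 h).elim r.not_winning fun hg =>
    e.not_mem (A.goal_subset_attractor N hg)
  not_mem := e.not_mem

/-- Against any strategy, the opponent can stay outside of an attractor that is closed under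
`cpre` for ever. -/
theorem mem_attractor_of_mem_winningStates {q : Fin A.locs} {y : Fin A.clocks → ℝ} {N : ℕ}
    (hN : ∀ s ∈ A.cpre (A.attractor N), s.2 ∈ clockValuations A.clocks → s ∈ A.attractor N)
    (h : (q, y) ∈ A.toHybrid.winningStates) : (q, y) ∈ A.attractor N := by
  obtain ⟨hy, s, hs⟩ := h
  by_contra hout
  obtain ⟨c, hc⟩ := exists_config q hy
  obtain ⟨hfin, hinf⟩ := hs c (congrArg Prod.fst hc) (congrArg Prod.snd hc)
  have hnext : ∀ r : EscapingRun s N c, Nonempty (EscapingStep r) := by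
    intro r
    rcases hch : s.choice r.run with _ | ⟨τ, a⟩
    · exact absurd (hfin _ r.run r.consistent hch) r.not_winning
    · have hv := s.valid r.run τ a hch
      have hnot : configState r.last ∉ A.cpre (A.attractor N) := fun hmem =>
        r.not_mem (hN _ hmem (configState_snd_mem _))
      rw [mem_cpre_iff] at hnot
      push Not at hnot
      obtain ⟨τ', a', c', hstep, hall, hc'⟩ := hnot τ a hv.1 hv.2
      refine ⟨⟨τ', a', c', hstep, fun τ₁ a₁ h₁ => ?_, hc'⟩⟩
      rw [hch] at h₁
      cases h₁
      exact hall
  let next : ∀ r : EscapingRun s N c, EscapingStep r := fun r => (hnext r).some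
  have hgoal : c.loc ∉ A.toHybrid.goal := fun hg =>
    hout (hc ▸ A.goal_subset_attractor N (s := configState c) hg)
  let S : ℕ → EscapingRun s N c := fun i => Nat.rec
    ⟨c, .nil c, consistent_nil s c, fun h => hgoal ((winning_nil_iff c).1 h), hc ▸ hout⟩
    (fun _ r => (next r).extend) i
  let r : A.toHybrid.InfRun :=
    ⟨fun i => (S i).last, fun i => (next (S i)).delay, fun i => (next (S i)).act,
      fun i => (next (S i)).step⟩
  have hprefix : ∀ i, r.prefixRun i = (S i).run := by
    intro i
    induction i with
    | zero => rfl
    | succ i ih =>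
      rw [HybridGame.InfRun.prefixRun, ih]
      rfl
  obtain ⟨i, hi⟩ := hinf r rfl fun i => by
    rw [hprefix]
    exact (next (S i)).allows
  exact (S i).not_mem (A.goal_subset_attractor N hi)

end strategies

/-! ### Regions -/

/-- The value of a clock, or `0` for the fictitious clock `none`. -/
def clockValue {n : ℕ} (y : Fin n → ℝ) (i : Option (Fin n)) : ℝ := i.elim 0 y

/-- Two clock valuations are region equivalent if they satisfy the same strict comparisons of
differences of clocks with the numbers `k / D`, where `|k| ≤ K`; comparisons of single clocks
are included by means of the fictitious clock `0`. -/
def RegionEquiv (D K : ℕ) {n : ℕ} (y y' : Fin n → ℝ) : Prop :=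
  ∀ (i j : Option (Fin n)) (k : ℤ), |k| ≤ K →
    (clockValue y i - clockValue y j < k / D ↔ clockValue y' i - clockValue y' j < k / D)

theorem RegionEquiv.symm {D K n : ℕ} {y y' : Fin n → ℝ} (h : RegionEquiv D K y y') :
    RegionEquiv D K y' y := fun i j k hk => (h i j k hk).symm

/-- The constants of the clock constraint are of the form `k / D` with `k ≤ K`. -/
def ClockConstraint.Bounded (D K : ℕ) {n : ℕ} : ClockConstraint n → Prop
  | le _ c => ∃ k : ℕ, k ≤ K ∧ (c : ℝ) = k / D
  | ge _ c => ∃ k : ℕ, k ≤ K ∧ (c : ℝ) = k / D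
  | not g => g.Bounded D K
  | and g h => g.Bounded D K ∧ h.Bounded D K

theorem RegionEquiv.sat_iff {D K n : ℕ} {y y' : Fin n → ℝ} (h : RegionEquiv D K y y')
    {g : ClockConstraint n} (hg : g.Bounded D K) : g.Sat y ↔ g.Sat y' := by
  induction g with
  | le i c =>
    obtain ⟨k, hk, hc⟩ := hg
    have := h none (some i) (-k) (by rw [abs_neg, Nat.abs_cast]; exact_mod_cast hk)
    simp only [clockValue, Option.elim, zero_sub, Int.cast_neg, Int.cast_natCast, neg_div,
      neg_lt_neg_iff, ← hc] at this
    rw [ClockConstraint.Sat, ClockConstraint.Sat, ← not_lt, this, not_lt]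
  | ge i c =>
    obtain ⟨k, hk, hc⟩ := hg
    have := h (some i) none k (by rw [Nat.abs_cast]; exact_mod_cast hk)
    simp only [clockValue, Option.elim, sub_zero, Int.cast_natCast, ← hc] at this
    rw [ClockConstraint.Sat, ClockConstraint.Sat, ← not_lt, this, not_lt]
  | not g ih => exact not_congr (ih hg)
  | and g₁ g₂ ih₁ ih₂ => exact and_congr (ih₁ hg.1) (ih₂ hg.2)

theorem RegionEquiv.resetAt {D K n m k : ℕ} {y y' : Fin n → ℝ} (h : RegionEquiv D K y y')
    (e : TimedEdge n m k) : RegionEquiv D K (e.resetAt y) (e.resetAt y') := by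
  -- after a reset, a clock has the value of some clock before it, perhaps the fictitious one
  have key : ∀ i : Option (Fin n), ∃ j, ∀ z : Fin n → ℝ,
      clockValue (e.resetAt z) i = clockValue z j := by
    intro i
    rcases i with _ | i
    · exact ⟨none, fun z => rfl⟩
    · by_cases hi : i ∈ e.reset
      · exact ⟨none, fun z => if_pos hi⟩
      · exact ⟨some i, fun z => if_neg hi⟩
  choose f hf using key
  intro i j k hk
  simp only [hf]
  exact h _ _ k hk

/-- The delays after which some clock reaches one of the relevant constants. For the fictitious
clock and the constant `0` this is the delay `0`. -/
noncomputable def criticalDelay (D K : ℕ) {n : ℕ} (y : Fin n → ℝ)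
    (p : Option (Fin n) × Fin (K + 1)) : ℝ :=
  (p.2 : ℕ) / D - clockValue y p.1

theorem RegionEquiv.criticalDelay_lt_iff {D K n : ℕ} {y y' : Fin n → ℝ}
    (h : RegionEquiv D K y y') (p q : Option (Fin n) × Fin (K + 1)) :
    criticalDelay D K y p < criticalDelay D K y q ↔
      criticalDelay D K y' p < criticalDelay D K y' q := by
  have key : ∀ z : Fin n → ℝ, criticalDelay D K z p < criticalDelay D K z q ↔
      clockValue z q.1 - clockValue z p.1 < (((q.2 : ℕ) - (p.2 : ℕ) : ℤ) : ℝ) / D := by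
    intro z
    push_cast
    rw [criticalDelay, criticalDelay, sub_div]
    constructor <;> intro h' <;> linarith
  rw [key, key]
  have h1 := p.2.2
  have h2 := q.2.2
  exact h _ _ _ (abs_le.2 ⟨by omega, by omega⟩)

/-- Delays that lie in the same way among the critical delays preserve region equivalence. -/
theorem RegionEquiv.delayed {D K n : ℕ} (hD : 0 < D) {y y' : Fin n → ℝ}
    (hy : y ∈ clockValuations n) (hy' : y' ∈ clockValuations n) (h : RegionEquiv D K y y')
    {τ τ' : ℝ} (hτ : 0 ≤ τ) (hτ' : 0 ≤ τ')
    (h1 : ∀ p, criticalDelay D K y p < τ ↔ criticalDelay D K y' p < τ')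
    (h2 : ∀ p, τ < criticalDelay D K y p ↔ τ' < criticalDelay D K y' p) :
    RegionEquiv D K (delayed y τ) (delayed y' τ') := by
  have hD' : (0 : ℝ) < D := by exact_mod_cast hD
  intro i j k hk
  rw [abs_le] at hk
  rcases i with _ | i <;> rcases j with _ | j
  · simp [clockValue]
  · have hj := delayed_mem hy hτ j
    have hj' := delayed_mem hy' hτ' j
    simp only [clockValue, Option.elim, zero_sub]
    rcases le_or_gt k 0 with hk0 | hk0
    · have := h1 (some j, ⟨(-k).toNat, by omega⟩)
      have e : (((-k).toNat : ℕ) : ℝ) = -k := by exact_mod_cast Int.toNat_of_nonneg (by omega)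
      simp only [criticalDelay, clockValue, Option.elim, e, neg_div] at this
      simp only [_root_.delayed]
      constructor <;> intro h'
      · linarith [this.1 (by linarith)]
      · linarith [this.2 (by linarith)]
    · have : (0 : ℝ) < k / D := div_pos (by exact_mod_cast hk0) hD'
      exact iff_of_true (by linarith) (by linarith)
  · have hi := delayed_mem hy hτ i
    have hi' := delayed_mem hy' hτ' i
    simp only [clockValue, Option.elim, sub_zero]
    rcases lt_or_ge k 0 with hk0 | hk0
    · have : (k : ℝ) / D < 0 := div_neg_of_neg_of_pos (by exact_mod_cast hk0) hD'
      exact iff_of_false (by linarith) (by linarith)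
    · have := h2 (some i, ⟨k.toNat, by omega⟩)
      have e : ((k.toNat : ℕ) : ℝ) = k := by exact_mod_cast Int.toNat_of_nonneg hk0
      simp only [criticalDelay, clockValue, Option.elim, e] at this
      simp only [_root_.delayed]
      constructor <;> intro h'
      · linarith [this.1 (by linarith)]
      · linarith [this.2 (by linarith)]
  · have := h (some i) (some j) k (abs_le.2 hk)
    simpa only [clockValue, Option.elim, _root_.delayed, add_sub_add_right_eq_sub] using this

/-- A set of states is saturated if it is a union of regions. -/
def Saturated (D K : ℕ) {n m : ℕ} (W : Set (Fin m × (Fin n → ℝ))) : Prop :=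
  ∀ q y y', y ∈ clockValuations n → y' ∈ clockValuations n → RegionEquiv D K y y' →
    (q, y) ∈ W → (q, y') ∈ W

/-- The constants of all guards of the timed game are of the form `k / D` with `k ≤ K`. -/
def TimedGame.Bounded (A : TimedGame) (D K : ℕ) : Prop :=
  ∀ e ∈ A.edges, e.guard.Bounded D K

/-- Region equivalence is a bisimulation, so that the controllable predecessors of a union of
regions form a union of regions. -/
theorem TimedGame.Bounded.saturated_cpre {A : TimedGame} {D K : ℕ} (hD : 0 < D)
    (hA : A.Bounded D K) {W : Set (Fin A.locs × (Fin A.clocks → ℝ))} (hW : Saturated D K W) :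
    Saturated D K (A.cpre W) := by
  rintro q y y' hy hy' h ⟨τ, hτ, ⟨e₀, he₀, hsrc, hctrl, hguard, hc⟩, hu⟩
  have nonneg : ∀ {z z' : Fin A.clocks → ℝ} {σ σ' : ℝ},
      (∀ p, σ < criticalDelay D K z p ↔ σ' < criticalDelay D K z' p) → 0 ≤ σ → 0 ≤ σ' := by
    intro z z' σ σ' h2 hσ
    have := h2 (none, 0)
    simp only [criticalDelay, clockValue, Option.elim, Fin.val_zero, Nat.cast_zero, zero_div,
      sub_zero] at this
    exact not_lt.1 fun h' => hσ.not_gt (this.2 h')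
  have transfer : ∀ {σ σ' : ℝ}, 0 ≤ σ → 0 ≤ σ' →
      RegionEquiv D K (delayed y σ) (delayed y' σ') → ∀ e : TimedEdge A.clocks A.locs A.acts,
      (e.tgt, e.resetAt (delayed y σ)) ∈ W → (e.tgt, e.resetAt (delayed y' σ')) ∈ W :=
    fun hσ hσ' hR e => hW _ _ _ (e.resetAt_mem (delayed_mem hy hσ))
      (e.resetAt_mem (delayed_mem hy' hσ')) (hR.resetAt e)
  obtain ⟨τ', h1, h2, -⟩ := exists_same_cut h.criticalDelay_lt_iff τ
  have hτ' := nonneg h2 hτ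
  have hR := h.delayed hD hy hy' hτ hτ' h1 h2
  refine ⟨τ', hτ', ⟨e₀, he₀, hsrc, hctrl, (hR.sat_iff (hA e₀ he₀)).1 hguard,
    fun e he hsrc' hact hguard' => ?_⟩, fun σ' hσ' hστ' e he hsrc' hact hguard' => ?_⟩
  · exact transfer hτ hτ' hR e (hc e he hsrc' hact ((hR.sat_iff (hA e he)).2 hguard'))
  · -- the delay `τ` is added to the critical delays, so that `σ` can be chosen below `τ`
    let f : Option (Option (Fin A.clocks) × Fin (K + 1)) → ℝ :=
      fun o => o.elim τ (criticalDelay D K y)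
    let f' : Option (Option (Fin A.clocks) × Fin (K + 1)) → ℝ :=
      fun o => o.elim τ' (criticalDelay D K y')
    have hord : ∀ i j, f' i < f' j ↔ f i < f j := by
      rintro (_ | i) (_ | j)
      · simp [f, f']
      · exact (h2 j).symm
      · exact (h1 i).symm
      · exact (h.criticalDelay_lt_iff i j).symm
    obtain ⟨σ, h3, h4, -⟩ := exists_same_cut hord σ'
    have hσ : 0 ≤ σ := nonneg (fun p => h4 (some p)) hσ'
    have hστ : σ ≤ τ := not_lt.1 fun h' => hστ'.not_gt ((h3 none).2 h')
    have hR' := h.delayed hD hy hy' hσ hσ' (fun p => (h3 (some p)).symm)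
      (fun p => (h4 (some p)).symm)
    exact transfer hσ hσ' hR' e
      (hu σ hσ hστ e he hsrc' hact ((hR'.sat_iff (hA e he)).2 hguard'))

theorem TimedGame.Bounded.saturated_attractor {A : TimedGame} {D K : ℕ} (hD : 0 < D)
    (hA : A.Bounded D K) (i : ℕ) : Saturated D K (A.attractor i) := by
  induction i with
  | zero => exact fun q y y' _ _ _ h => h
  | succ i ih =>
    exact fun q y y' hy hy' hR h => h.imp id (hA.saturated_cpre hD ih q y y' hy hy' hR)

/-- The region of a clock valuation, encoded by the comparisons that it satisfies. -/
def regionOf (D K : ℕ) {n : ℕ} (y : Fin n → ℝ) :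
    Option (Fin n) × Option (Fin n) × Fin (2 * K + 1) → Prop :=
  fun p => clockValue y p.1 - clockValue y p.2.1 < (((p.2.2 : ℕ) : ℝ) - K) / D

theorem regionEquiv_of_regionOf_eq {D K n : ℕ} {y y' : Fin n → ℝ}
    (h : regionOf D K y = regionOf D K y') : RegionEquiv D K y y' := by
  intro i j k hk
  rw [abs_le] at hk
  have := congrFun h (i, j, ⟨(k + K).toNat, by omega⟩)
  have e : (((k + K).toNat : ℕ) : ℝ) = k + K := by exact_mod_cast Int.toNat_of_nonneg (by omega)
  simp only [regionOf, e, add_sub_cancel_right, eq_iff_iff] at this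
  exact this

/-- A bound for the number of states up to region equivalence. -/
def regionCount (n m K : ℕ) : ℕ := m * 2 ^ ((n + 1) * ((n + 1) * (2 * K + 1)))

theorem TimedGame.cpre_congr (A : TimedGame) {W W' : Set (Fin A.locs × (Fin A.clocks → ℝ))}
    (h : ∀ s : Fin A.locs × (Fin A.clocks → ℝ), s.2 ∈ clockValuations A.clocks →
      s ∈ W → s ∈ W')
    {s : Fin A.locs × (Fin A.clocks → ℝ)} (hs : s.2 ∈ clockValuations A.clocks)
    (hW : s ∈ A.cpre W) : s ∈ A.cpre W' := by
  obtain ⟨τ, hτ, ⟨e₀, h₀, h1, h2, h3, h4⟩, h5⟩ := hW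
  exact ⟨τ, hτ,
    ⟨e₀, h₀, h1, h2, h3, fun e he h6 h7 h8 =>
      h _ (e.resetAt_mem (delayed_mem hs hτ)) (h4 e he h6 h7 h8)⟩,
    fun σ hσ hστ e he h6 h7 h8 =>
      h _ (e.resetAt_mem (delayed_mem hs hσ)) (h5 σ hσ hστ e he h6 h7 h8)⟩

/-- The attractors increase and are unions of regions, hence they become stationary after at
most as many steps as there are regions. -/
theorem TimedGame.Bounded.attractor_stationary {A : TimedGame} {D K : ℕ} (hD : 0 < D)
    (hA : A.Bounded D K) {N : ℕ} (hN : regionCount A.clocks A.locs K ≤ N) :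
    ∀ s ∈ A.cpre (A.attractor N), s.2 ∈ clockValuations A.clocks → s ∈ A.attractor N := by
  classical
  let T := Fin A.locs × (Option (Fin A.clocks) × Option (Fin A.clocks) × Fin (2 * K + 1) → Prop)
  let S : ℕ → Set T := fun i =>
    {t | ∃ s ∈ A.attractor i, s.2 ∈ clockValuations A.clocks ∧ (s.1, regionOf D K s.2) = t}
  have hmono : Monotone S := fun i j hij t ⟨s, hs, h⟩ => ⟨s, A.attractor_mono hij hs, h⟩
  have hmem : ∀ i (s : Fin A.locs × (Fin A.clocks → ℝ)), s.2 ∈ clockValuations A.clocks →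
      (s.1, regionOf D K s.2) ∈ S i → s ∈ A.attractor i := by
    rintro i ⟨q, y⟩ hy ⟨⟨q', y'⟩, hs', hy', h⟩
    rw [Prod.mk.injEq] at h
    obtain ⟨rfl, h⟩ := h
    exact hA.saturated_attractor hD i _ _ _ hy' hy (regionEquiv_of_regionOf_eq h) hs'
  have hstep : ∀ i, S (i + 1) ⊆ S i → ∀ s ∈ A.attractor (i + 1),
      s.2 ∈ clockValuations A.clocks → s ∈ A.attractor i := fun i hi s hs hs' =>
    hmem i s hs' (hi ⟨s, hs, hs', rfl⟩)
  have heq : ∀ i, (S i).ncard = (S (i + 1)).ncard → S (i + 1) ⊆ S i := fun i hi =>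
    (Set.eq_of_subset_of_ncard_le (hmono i.le_succ) hi.ge (Set.toFinite _)).ge
  have hcard : Nat.card T = regionCount A.clocks A.locs K := by
    simp only [T, Nat.card_eq_fintype_card, regionCount, Fintype.card_prod, Fintype.card_fin,
      Fintype.card_fun, Fintype.card_option, Fintype.card_prop]
  have hstab := fun n => Nat.stabilises_of_monotone (f := fun i => (S i).ncard) (b := Nat.card T) (n := n)
    (fun i j hij => Set.ncard_le_ncard (hmono hij) (Set.toFinite _))
    (fun i => Set.ncard_le_card _)
    (fun i hi => by
      refine le_antisymm (Set.ncard_le_ncard (hmono (i + 1).le_succ) (Set.toFinite _))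
        (Set.ncard_le_ncard ?_ (Set.toFinite _))
      rintro t ⟨s, hs, hs', rfl⟩
      exact ⟨s, hs.imp id fun h =>
        A.cpre_congr (fun s' h' h'' => hstep i (heq i hi) s' h'' h') hs' h, hs', rfl⟩)
  have hfin : (S N).ncard = (S (N + 1)).ncard := by
    rw [hcard] at hstab
    exact (hstab N hN).trans (hstab (N + 1) (hN.trans N.le_succ)).symm
  exact fun s hs hs' => hstep N (heq N hfin) s (Or.inr hs) hs'

/-- The winning states are the states in a sufficiently late attractor. -/
theorem TimedGame.Bounded.mem_winningStates_iff {A : TimedGame} {D K : ℕ} (hD : 0 < D)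
    (hA : A.Bounded D K) {N : ℕ} (hN : regionCount A.clocks A.locs K ≤ N) (q : Fin A.locs)
    (y : Fin A.clocks → ℝ) :
    (q, y) ∈ A.toHybrid.winningStates ↔
      y ∈ clockValuations A.clocks ∧ (q, y) ∈ A.attractor N :=
  ⟨fun h => ⟨h.1, mem_attractor_of_mem_winningStates (hA.attractor_stationary hD hN) h⟩,
    fun h => mem_winningStates_of_mem_attractor h.1 h.2⟩

/-! ### Formulas for clock constraints -/

theorem primrecRel_mem : PrimrecRel fun (L : List ℕ) (a : ℕ) => a ∈ L :=
  (Primrec.eq.exists_mem_list (α := ℕ) (β := ℕ)).of_eq fun L a => by simp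

/-- From the code of a clock constraint and the codes of terms for the clocks, a formula for the
constraint is computed by a primitive recursive function. -/
theorem exists_primrec_guardFormula :
    ∃ f : ℕ × List ℕ → ℕ, Primrec f ∧ ∀ (n k : ℕ) (g : ClockConstraint n) (ts : List ℕ),
      (∀ j < n, IsTermCode n k (ts.getD j 0)) → IsFormulaCode n k (f (g.code, ts)) ∧
        ∀ l : List ℝ, l.getD 0 0 = 1 →
          (codeSat n (f (g.code, ts)) l ↔ g.Sat fun j => termVal n l (ts.getD j 0)) := by
  have hc : Primrec fun b : ℕ × List ℕ => b.1 := Primrec.fst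
  have hts : Primrec fun b : ℕ × List ℕ => b.2 := Primrec.snd
  have hc' := hc.comp (Primrec.fst (α := ℕ × List ℕ) (β := List ℕ))
  have hr : ∀ j : ℕ, Primrec fun p : (ℕ × List ℕ) × List ℕ => p.2.getD j 0 := fun j =>
    (Primrec.list_getD 0).comp Primrec.snd (.const j)
  have hnum : Primrec fun b : ℕ × List ℕ => mulCode b.1.unpair.2.unpair.2.unpair.1 oneCode :=
    primrec_mulCode (Primrec.fst.comp (Primrec.unpair.comp (primrec_bodySnd hc))) (.const _)
  have hden : Primrec fun b : ℕ × List ℕ =>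
      mulCode b.1.unpair.2.unpair.2.unpair.2 (b.2.getD b.1.unpair.2.unpair.1 0) :=
    primrec_mulCode (primrec_body (primrec_bodySnd hc))
      ((Primrec.list_getD 0).comp hts (primrec_bodyFst hc))
  obtain ⟨f, hf, hf'⟩ := exists_primrec_treeRec (β := ℕ × List ℕ) (σ := ℕ) (m := fun b => b.1)
    (l := fun b =>
      if b.1.unpair.1 = 2 then [(b.1.unpair.2, b.2)]
      else if b.1.unpair.1 = 3 then
        [(b.1.unpair.2.unpair.1, b.2), (b.1.unpair.2.unpair.2, b.2)]
      else [])
    (g := fun b rs =>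
      if b.1.unpair.1 = 0 then
        notCode (ltCode (mulCode b.1.unpair.2.unpair.2.unpair.1 oneCode)
          (mulCode b.1.unpair.2.unpair.2.unpair.2 (b.2.getD b.1.unpair.2.unpair.1 0)))
      else if b.1.unpair.1 = 1 then
        notCode (ltCode
          (mulCode b.1.unpair.2.unpair.2.unpair.2 (b.2.getD b.1.unpair.2.unpair.1 0))
          (mulCode b.1.unpair.2.unpair.2.unpair.1 oneCode))
      else if b.1.unpair.1 = 2 then notCode (rs.getD 0 0)
      else andCode (rs.getD 0 0) (rs.getD 1 0)) hc
    (Primrec.ite (primrec_tagEq hc 2)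
        (Primrec.list_cons.comp ((primrec_body hc).pair hts) (.const [])) <|
      Primrec.ite (primrec_tagEq hc 3)
        (Primrec.list_cons.comp ((primrec_bodyFst hc).pair hts)
          (Primrec.list_cons.comp ((primrec_bodySnd hc).pair hts) (.const [])))
        (.const []))
    (Primrec.ite (primrec_tagEq hc' 0)
        ((primrec_notCode (primrec_ltCode hnum hden)).comp Primrec.fst) <|
      Primrec.ite (primrec_tagEq hc' 1)
        ((primrec_notCode (primrec_ltCode hden hnum)).comp Primrec.fst) <|
      Primrec.ite (primrec_tagEq hc' 2) (primrec_notCode (hr 0))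
        (primrec_andCode (hr 0) (hr 1))).to₂
    (fun b b' hb' => by
      split_ifs at hb' with h2 h3
      · obtain rfl := List.mem_singleton.1 hb'
        exact unpair_snd_lt (by omega)
      · simp only [List.mem_cons, List.not_mem_nil, or_false] at hb'
        rcases hb' with rfl | rfl
        · exact unpair_snd_unpair_fst_lt (by omega)
        · exact unpair_snd_unpair_snd_lt (by omega)
      · simp at hb')
  refine ⟨f, hf, fun n k g ts hts => ?_⟩
  have hq : ∀ c : ℚ≥0, (c : ℝ) = (c.num : ℝ) / (c.den : ℝ) := fun c => by
    conv_lhs => rw [← NNRat.num_div_den c]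
    push_cast
    rfl
  have hpos : ∀ c : ℚ≥0, (0 : ℝ) < c.den := fun c => by exact_mod_cast c.den_pos
  induction g with
  | le i c =>
    rw [hf']
    simp only [ClockConstraint.code, Nat.unpair_pair, if_true]
    refine ⟨(IsFormulaCode.lt ((IsTermCode.one n k).mul _) ((hts i i.2).mul _)).not,
      fun l hl => ?_⟩
    rw [codeSat_notCode, codeSat_ltCode, termVal_mulCode, termVal_mulCode, termVal_oneCode, hl,
      not_lt, mul_one, ClockConstraint.Sat, hq c, le_div_iff₀ (hpos c), mul_comm]
  | ge i c =>
    rw [hf']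
    simp only [ClockConstraint.code, Nat.unpair_pair, one_ne_zero, if_false, if_true]
    refine ⟨(IsFormulaCode.lt ((hts i i.2).mul _) ((IsTermCode.one n k).mul _)).not,
      fun l hl => ?_⟩
    rw [codeSat_notCode, codeSat_ltCode, termVal_mulCode, termVal_mulCode, termVal_oneCode, hl,
      not_lt, mul_one, ClockConstraint.Sat, hq c, div_le_iff₀ (hpos c), mul_comm]
  | not g ih =>
    have : f (g.not.code, ts) = notCode (f (g.code, ts)) := by
      rw [hf']
      simp [ClockConstraint.code]
    rw [this]
    exact ⟨ih.1.not, fun l hl => by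
      rw [codeSat_notCode, ih.2 l hl, ClockConstraint.Sat]⟩
  | and g h ihg ihh =>
    have : f ((g.and h).code, ts) = andCode (f (g.code, ts)) (f (h.code, ts)) := by
      rw [hf']
      simp [ClockConstraint.code]
    rw [this]
    exact ⟨ihg.1.and ihh.1, fun l hl => by
      rw [codeSat_andCode, ihg.2 l hl, ihh.2 l hl, ClockConstraint.Sat]⟩

/-! ### Formulas for the attractors -/

/-- Codes of terms for the clocks after a reset of the clocks in `ρ`. -/
def resetTerms (n : ℕ) (ts ρ : List ℕ) : List ℕ :=
  (List.range n).map fun j => if j ∈ ρ then zeroCode else ts.getD j 0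

/-- Codes of terms for the clocks after the delay given by the term with code `t`. -/
def delayTerms (n : ℕ) (ts : List ℕ) (t : ℕ) : List ℕ :=
  (List.range n).map fun j => addCode (ts.getD j 0) t

theorem getD_map_range {n j : ℕ} (hj : j < n) (f : ℕ → ℕ) :
    ((List.range n).map f).getD j 0 = f j := by
  simp [List.getD_eq_getElem?_getD, hj]

/-- What is recorded of a transition: its source, its action, a formula for its guard, and a
formula saying that the state to which it leads lies in an attractor. -/
abbrev EdgeFormulas : Type := ℕ × ℕ × ℕ × ℕ

/-- The conjunction of `guard → target` over the recorded transitions from `q` labelled `a`. -/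
def forcedByAction (q a : ℕ) (rs : List EdgeFormulas) : ℕ :=
  conjCode (rs.map fun r =>
    if r.1 = q ∧ r.2.1 = a then impCode r.2.2.1 r.2.2.2 else notCode falseCode)

/-- The conjunction of `guard → target` over the recorded uncontrollable transitions from `q`. -/
def forcedByOpponent (ctrl : List ℕ) (q : ℕ) (rs : List EdgeFormulas) : ℕ :=
  conjCode (rs.map fun r =>
    if r.1 = q ∧ r.2.1 ∉ ctrl then impCode r.2.2.1 r.2.2.2 else notCode falseCode)

/-- The disjunction over the controllable actions that are enabled in `q`. -/
def someActionForces (ctrl : List ℕ) (q : ℕ) (rs : List EdgeFormulas) : ℕ :=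
  disjCode (rs.map fun r =>
    if r.1 = q ∧ r.2.1 ∈ ctrl then andCode r.2.2.1 (forcedByAction q r.2.1 rs) else falseCode)

/-- A formula for the controllable predecessors at the location `q`. The controller's delay is
the bound variable `z_k`, the opponent's delay is `z_{k+1}`. -/
def cpreCode (ctrl : List ℕ) (q k : ℕ) (rs : List EdgeFormulas) : ℕ :=
  exCode (allCode (andCode (notCode (ltCode (Nat.pair 1 k) zeroCode))
    (andCode (someActionForces ctrl q rs)
      (impCode (andCode (notCode (ltCode (Nat.pair 1 (k + 1)) zeroCode))
        (notCode (ltCode (Nat.pair 1 k) (Nat.pair 1 (k + 1)))))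
        (forcedByOpponent ctrl q rs)))))

section cpreCode

variable {n k : ℕ} {rs : List EdgeFormulas}

theorem IsFormulaCode.cpre (ctrl : List ℕ) (q : ℕ)
    (hrs : ∀ r ∈ rs, IsFormulaCode n (k + 2) r.2.2.1 ∧ IsFormulaCode n (k + 2) r.2.2.2) :
    IsFormulaCode n k (cpreCode ctrl q k rs) := by
  have hz : IsTermCode n (k + 2) zeroCode := .zero n _
  have h0 : IsTermCode n (k + 2) (Nat.pair 1 k) := .bound n (by omega)
  have h1 : IsTermCode n (k + 2) (Nat.pair 1 (k + 1)) := .bound n (by omega)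
  have htrue : IsFormulaCode n (k + 2) (notCode falseCode) := (IsFormulaCode.false n _).not
  have hact : ∀ a, IsFormulaCode n (k + 2) (forcedByAction q a rs) := fun a => .conj fun c hc => by
    obtain ⟨r, hr, rfl⟩ := List.mem_map.1 hc
    split_ifs
    · exact (hrs r hr).1.imp (hrs r hr).2
    · exact htrue
  refine ((IsFormulaCode.lt h0 hz).not.and (IsFormulaCode.and (.disj fun c hc => ?_)
    (((IsFormulaCode.lt h1 hz).not.and (IsFormulaCode.lt h0 h1).not).imp
      (.conj fun c hc => ?_)))).all.ex
  · obtain ⟨r, hr, rfl⟩ := List.mem_map.1 hc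
    split_ifs
    · exact (hrs r hr).1.and (hact _)
    · exact .false n _
  · obtain ⟨r, hr, rfl⟩ := List.mem_map.1 hc
    split_ifs
    · exact (hrs r hr).1.imp (hrs r hr).2
    · exact htrue

theorem codeSat_forcedByAction (n q a : ℕ) (l : List ℝ) :
    codeSat n (forcedByAction q a rs) l ↔ ∀ r ∈ rs, r.1 = q → r.2.1 = a →
      codeSat n r.2.2.1 l → codeSat n r.2.2.2 l := by
  rw [forcedByAction, codeSat_conjCode, List.forall_mem_map]
  refine forall₂_congr fun r _ => ?_
  split_ifs with h
  · simp [codeSat_impCode, h.1, h.2]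
  · simp only [codeSat_notCode, codeSat_falseCode, not_false_eq_true, true_iff]
    exact fun h1 h2 => absurd ⟨h1, h2⟩ h

theorem codeSat_forcedByOpponent (n : ℕ) (ctrl : List ℕ) (q : ℕ) (l : List ℝ) :
    codeSat n (forcedByOpponent ctrl q rs) l ↔ ∀ r ∈ rs, r.1 = q → r.2.1 ∉ ctrl →
      codeSat n r.2.2.1 l → codeSat n r.2.2.2 l := by
  rw [forcedByOpponent, codeSat_conjCode, List.forall_mem_map]
  refine forall₂_congr fun r _ => ?_
  split_ifs with h
  · simp [codeSat_impCode, h.1, h.2]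
  · simp only [codeSat_notCode, codeSat_falseCode, not_false_eq_true, true_iff]
    exact fun h1 h2 => absurd ⟨h1, h2⟩ h

theorem codeSat_someActionForces (n : ℕ) (ctrl : List ℕ) (q : ℕ) (l : List ℝ) :
    codeSat n (someActionForces ctrl q rs) l ↔ ∃ r₀ ∈ rs, r₀.1 = q ∧ r₀.2.1 ∈ ctrl ∧
      codeSat n r₀.2.2.1 l ∧ ∀ r ∈ rs, r.1 = q → r.2.1 = r₀.2.1 →
        codeSat n r.2.2.1 l → codeSat n r.2.2.2 l := by
  rw [someActionForces, codeSat_disjCode]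
  simp only [List.mem_map, exists_exists_and_eq_and]
  refine exists_congr fun r => and_congr_right fun _ => ?_
  split_ifs with h
  · simp [codeSat_andCode, codeSat_forcedByAction, h.1, h.2]
  · simp only [codeSat_falseCode, false_iff]
    exact fun h' => h ⟨h'.1, h'.2.1⟩

theorem codeSat_cpreCode (ctrl : List ℕ) (q : ℕ) {l : List ℝ} (hl : l.length = 1 + n + k) :
    codeSat n (cpreCode ctrl q k rs) l ↔ ∃ τ : ℝ, ∀ σ : ℝ, 0 ≤ τ ∧
      (∃ r₀ ∈ rs, r₀.1 = q ∧ r₀.2.1 ∈ ctrl ∧ codeSat n r₀.2.2.1 (l ++ [τ] ++ [σ]) ∧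
        ∀ r ∈ rs, r.1 = q → r.2.1 = r₀.2.1 → codeSat n r.2.2.1 (l ++ [τ] ++ [σ]) →
          codeSat n r.2.2.2 (l ++ [τ] ++ [σ])) ∧
      (0 ≤ σ → σ ≤ τ → ∀ r ∈ rs, r.1 = q → r.2.1 ∉ ctrl →
        codeSat n r.2.2.1 (l ++ [τ] ++ [σ]) → codeSat n r.2.2.2 (l ++ [τ] ++ [σ])) := by
  have h0 : ∀ τ σ : ℝ, termVal n (l ++ [τ] ++ [σ]) (Nat.pair 1 k) = τ := fun τ σ => by
    rw [termVal_bound, ← hl, List.getD_append _ _ _ _ (by simp),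
      List.getD_append_right _ _ _ _ le_rfl]
    simp
  have h1 : ∀ τ σ : ℝ, termVal n (l ++ [τ] ++ [σ]) (Nat.pair 1 (k + 1)) = σ := fun τ σ => by
    rw [termVal_bound, ← add_assoc, ← hl, List.getD_append_right _ _ _ _ (by simp)]
    simp
  rw [cpreCode, codeSat_exCode]
  simp only [codeSat_allCode, codeSat_andCode, codeSat_notCode, codeSat_impCode, codeSat_ltCode,
    h0, h1, termVal_zeroCode, not_lt, codeSat_someActionForces, codeSat_forcedByOpponent,
    and_imp]

end cpreCode

section primrec

variable {α : Type} [Primcodable α]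

theorem primrec_resetTerms {n : α → ℕ} {ts ρ : α → List ℕ} (hn : Primrec n) (hts : Primrec ts)
    (hρ : Primrec ρ) : Primrec fun a => resetTerms (n a) (ts a) (ρ a) :=
  Primrec.list_map (Primrec.list_range.comp hn)
    (Primrec.ite (primrecRel_mem.comp (hρ.comp Primrec.fst) Primrec.snd) (.const zeroCode)
      ((Primrec.list_getD 0).comp (hts.comp Primrec.fst) Primrec.snd)).to₂

theorem primrec_delayTerms {n t : α → ℕ} {ts : α → List ℕ} (hn : Primrec n) (hts : Primrec ts)
    (ht : Primrec t) : Primrec fun a => delayTerms (n a) (ts a) (t a) :=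
  Primrec.list_map (Primrec.list_range.comp hn)
    (primrec_addCode ((Primrec.list_getD 0).comp (hts.comp Primrec.fst) Primrec.snd)
      (ht.comp Primrec.fst)).to₂

variable {ctrl : α → List ℕ} {q k a : α → ℕ} {rs : α → List EdgeFormulas}

theorem primrec_impEdge {r : α → EdgeFormulas} (hr : Primrec r) :
    Primrec fun x => impCode (r x).2.2.1 (r x).2.2.2 :=
  have h := Primrec.snd.comp (Primrec.snd.comp hr)
  primrec_impCode (Primrec.fst.comp h) (Primrec.snd.comp h)

theorem primrec_forcedByAction (hq : Primrec q) (ha : Primrec a) (hrs : Primrec rs) :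
    Primrec fun x => forcedByAction (q x) (a x) (rs x) :=
  primrec_conjCode (Primrec.list_map hrs (Primrec.ite
    ((Primrec.eq.comp (Primrec.fst.comp Primrec.snd) (hq.comp Primrec.fst)).and
      (Primrec.eq.comp (Primrec.fst.comp (Primrec.snd.comp Primrec.snd)) (ha.comp Primrec.fst)))
    (primrec_impEdge Primrec.snd) (.const _)).to₂)

theorem primrec_forcedByOpponent (hctrl : Primrec ctrl) (hq : Primrec q) (hrs : Primrec rs) :
    Primrec fun x => forcedByOpponent (ctrl x) (q x) (rs x) :=
  primrec_conjCode (Primrec.list_map hrs (Primrec.ite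
    ((Primrec.eq.comp (Primrec.fst.comp Primrec.snd) (hq.comp Primrec.fst)).and
      (primrecRel_mem.comp (hctrl.comp Primrec.fst)
        (Primrec.fst.comp (Primrec.snd.comp Primrec.snd))).not)
    (primrec_impEdge Primrec.snd) (.const _)).to₂)

theorem primrec_someActionForces (hctrl : Primrec ctrl) (hq : Primrec q) (hrs : Primrec rs) :
    Primrec fun x => someActionForces (ctrl x) (q x) (rs x) :=
  have ha : Primrec fun p : α × EdgeFormulas => p.2.2.1 :=
    Primrec.fst.comp (Primrec.snd.comp Primrec.snd)
  primrec_disjCode (Primrec.list_map hrs (Primrec.ite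
    ((Primrec.eq.comp (Primrec.fst.comp Primrec.snd) (hq.comp Primrec.fst)).and
      (primrecRel_mem.comp (hctrl.comp Primrec.fst) ha))
    (primrec_andCode (Primrec.fst.comp (Primrec.snd.comp (Primrec.snd.comp Primrec.snd)))
      (primrec_forcedByAction (hq.comp Primrec.fst) ha (hrs.comp Primrec.fst)))
    (.const _)).to₂)

theorem primrec_cpreCode (hctrl : Primrec ctrl) (hq : Primrec q) (hk : Primrec k)
    (hrs : Primrec rs) : Primrec fun x => cpreCode (ctrl x) (q x) (k x) (rs x) :=
  have h0 : Primrec fun x => Nat.pair 1 (k x) := primrec_pairConst 1 hk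
  have h1 : Primrec fun x => Nat.pair 1 (k x + 1) := primrec_pairConst 1 (Primrec.succ.comp hk)
  primrec_exCode (primrec_allCode (primrec_andCode
    (primrec_notCode (primrec_ltCode h0 (.const _)))
    (primrec_andCode (primrec_someActionForces hctrl hq hrs)
      (primrec_impCode (primrec_andCode (primrec_notCode (primrec_ltCode h1 (.const _)))
        (primrec_notCode (primrec_ltCode h0 h1))) (primrec_forcedByOpponent hctrl hq hrs)))))

end primrec

/-- Codes of transitions. -/
abbrev EdgeCode : Type := ℕ × ℕ × ℕ × List ℕ × ℕ

/-- Nodes of the recursion that computes formulas for the attractors: the code of a timed game,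
the number of moves, the code of a transition, the codes of terms for the clocks before the
transition, and the number of bound variables in use. -/
abbrev AttractorNode : Type := TimedGameCode × ℕ × EdgeCode × List ℕ × ℕ

/-- The children of a node: the transitions that may follow. Those with a controllable action
are taken after the controller's delay, the others after the opponent's delay. -/
def AttractorNode.children (b : AttractorNode) : List AttractorNode :=
  if b.2.1 = 0 then [] else b.1.2.2.2.2.2.map fun e =>
    (b.1, b.2.1 - 1, e,
      delayTerms b.1.1 (resetTerms b.1.1 b.2.2.2.1 b.2.2.1.2.2.2.1)
        (Nat.pair 1 (if e.2.2.1 ∈ b.1.2.2.2.2.1 then b.2.2.2.2 else b.2.2.2.2 + 1)),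
      b.2.2.2.2 + 2)

theorem primrec_attractorNode_children : Primrec AttractorNode.children := by
  have hG : Primrec fun b : AttractorNode => b.1 := Primrec.fst
  have hGs := Primrec.snd.comp (Primrec.snd.comp (Primrec.snd.comp hG))
  have hctrl : Primrec fun b : AttractorNode => b.1.2.2.2.2.1 :=
    Primrec.fst.comp (Primrec.snd.comp hGs)
  have hedges : Primrec fun b : AttractorNode => b.1.2.2.2.2.2 :=
    Primrec.snd.comp (Primrec.snd.comp hGs)
  have hi : Primrec fun b : AttractorNode => b.2.1 := Primrec.fst.comp Primrec.snd
  have he : Primrec fun b : AttractorNode => b.2.2.1 :=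
    Primrec.fst.comp (Primrec.snd.comp Primrec.snd)
  have hts : Primrec fun b : AttractorNode => b.2.2.2.1 :=
    Primrec.fst.comp (Primrec.snd.comp (Primrec.snd.comp Primrec.snd))
  have hk : Primrec fun b : AttractorNode => b.2.2.2.2 :=
    Primrec.snd.comp (Primrec.snd.comp (Primrec.snd.comp Primrec.snd))
  have hρ : Primrec fun b : AttractorNode => b.2.2.1.2.2.2.1 :=
    Primrec.fst.comp (Primrec.snd.comp (Primrec.snd.comp (Primrec.snd.comp he)))
  have hn : Primrec fun b : AttractorNode => b.1.1 := Primrec.fst.comp hG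
  have hf := Primrec.fst (α := AttractorNode) (β := EdgeCode)
  have hact : Primrec fun p : AttractorNode × EdgeCode => p.2.2.2.1 :=
    Primrec.fst.comp (Primrec.snd.comp (Primrec.snd.comp Primrec.snd))
  have hdelay : Primrec fun p : AttractorNode × EdgeCode => Nat.pair 1
      (if p.2.2.2.1 ∈ p.1.1.2.2.2.2.1 then p.1.2.2.2.2 else p.1.2.2.2.2 + 1) :=
    primrec_pairConst 1 (Primrec.ite (primrecRel_mem.comp (hctrl.comp hf) hact) (hk.comp hf)
      (Primrec.succ.comp (hk.comp hf)))
  exact Primrec.ite (Primrec.eq.comp hi (.const 0)) (.const [])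
    (Primrec.list_map hedges ((hG.comp hf).pair ((Primrec.pred.comp (hi.comp hf)).pair
      (Primrec.snd.pair ((primrec_delayTerms (hn.comp hf)
        ((primrec_resetTerms hn hts hρ).comp hf) hdelay).pair
        (Primrec.succ.comp (Primrec.succ.comp (hk.comp hf))))))).to₂)

/-- The formula, at a node, saying that the target of its transition lies in an attractor, in
terms of the results at the children. -/
def AttractorNode.target (b : AttractorNode) (rs : List EdgeFormulas) : ℕ :=
  if b.2.2.1.2.2.2.2 ∈ b.1.2.2.2.1 then notCode falseCode
  else cpreCode b.1.2.2.2.2.1 b.2.2.1.2.2.2.2 b.2.2.2.2 rs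

theorem primrec_attractorNode_target : Primrec₂ AttractorNode.target := by
  have hG : Primrec fun p : AttractorNode × List EdgeFormulas => p.1.1 :=
    Primrec.fst.comp Primrec.fst
  have hGs := Primrec.snd.comp (Primrec.snd.comp (Primrec.snd.comp hG))
  have hb := Primrec.snd.comp (Primrec.snd.comp
    (Primrec.fst (α := AttractorNode) (β := List EdgeFormulas)))
  have hq : Primrec fun p : AttractorNode × List EdgeFormulas => p.1.2.2.1.2.2.2.2 :=
    Primrec.snd.comp (Primrec.snd.comp (Primrec.snd.comp (Primrec.snd.comp
      (Primrec.fst.comp hb))))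
  exact (Primrec.ite (primrecRel_mem.comp (Primrec.fst.comp hGs) hq) (.const _)
    (primrec_cpreCode (Primrec.fst.comp (Primrec.snd.comp hGs)) hq
      (Primrec.snd.comp (Primrec.snd.comp hb)) Primrec.snd)).to₂

theorem IsTermCode.reset {n k : ℕ} {ts : List ℕ} (h : ∀ j < n, IsTermCode n k (ts.getD j 0))
    (ρ : List ℕ) : ∀ j < n, IsTermCode n k ((resetTerms n ts ρ).getD j 0) := by
  intro j hj
  rw [resetTerms, getD_map_range hj]
  split_ifs
  · exact .zero n k
  · exact h j hj

theorem IsTermCode.delay {n k : ℕ} {ts : List ℕ} (h : ∀ j < n, IsTermCode n k (ts.getD j 0))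
    {i : ℕ} (hi : i < 2) :
    ∀ j < n, IsTermCode n (k + 2) ((delayTerms n ts (Nat.pair 1 (k + i))).getD j 0) := by
  intro j hj
  rw [delayTerms, getD_map_range hj]
  exact (h j hj).succ.succ.add (.bound n (by omega))

/-- Formulas for the attractors of a timed game, evaluated at the targets of transitions, are
computed by a primitive recursive function. -/
theorem exists_primrec_attractorFormula :
    ∃ f : AttractorNode → ℕ, Primrec f ∧ ∀ (A : TimedGame) (i s g a : ℕ)
      (ρ : List (Fin A.clocks)) (q : Fin A.locs) (k : ℕ) (ts : List ℕ),
      (∀ j < A.clocks, IsTermCode A.clocks k (ts.getD j 0)) →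
        IsFormulaCode A.clocks k (f (A.code, i, (s, g, a, ρ.map Fin.val, q), ts, k)) ∧
        ∀ l : List ℝ, l.length = 1 + A.clocks + k → l.getD 0 0 = 1 →
          (codeSat A.clocks (f (A.code, i, (s, g, a, ρ.map Fin.val, q), ts, k)) l ↔
            (q, fun j : Fin A.clocks => if j ∈ ρ then 0 else
              termVal A.clocks l (ts.getD j 0)) ∈ A.attractor i) := by
  obtain ⟨γ, hγ, hγ'⟩ := exists_primrec_guardFormula
  have he : Primrec fun p : AttractorNode × List EdgeFormulas => p.1.2.2.1 :=
    Primrec.fst.comp (Primrec.snd.comp (Primrec.snd.comp Primrec.fst))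
  have hts : Primrec fun p : AttractorNode × List EdgeFormulas => p.1.2.2.2.1 :=
    Primrec.fst.comp (Primrec.snd.comp (Primrec.snd.comp (Primrec.snd.comp Primrec.fst)))
  have hg : Primrec₂ fun (b : AttractorNode) (rs : List EdgeFormulas) =>
      ((b.2.2.1.1, b.2.2.1.2.2.1, γ (b.2.2.1.2.1, b.2.2.2.1), b.target rs) : EdgeFormulas) :=
    ((Primrec.fst.comp he).pair ((Primrec.fst.comp (Primrec.snd.comp (Primrec.snd.comp he))).pair
      ((hγ.comp ((Primrec.fst.comp (Primrec.snd.comp he)).pair hts)).pair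
        primrec_attractorNode_target))).to₂
  obtain ⟨F, hF, hF'⟩ := exists_primrec_treeRec (m := fun b : AttractorNode => b.2.1)
    (Primrec.fst.comp Primrec.snd) primrec_attractorNode_children hg (fun b b' hb' => by
      unfold AttractorNode.children at hb'
      split_ifs at hb' with h0
      · simp at hb'
      · obtain ⟨e, -, rfl⟩ := List.mem_map.1 hb'
        exact Nat.pred_lt h0)
  refine ⟨fun b => (F b).2.2.2,
    Primrec.snd.comp (Primrec.snd.comp (Primrec.snd.comp hF)), fun A i => ?_⟩
  have hgoal : ∀ q : Fin A.locs, (q : ℕ) ∈ A.goal.map Fin.val ↔ q ∈ A.goal := fun q => by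
    simp [Fin.val_inj]
  have hctrl : ∀ a : Fin A.acts, (a : ℕ) ∈ A.ctrl.map Fin.val ↔ a ∈ A.ctrl := fun a => by
    simp [Fin.val_inj]
  have hmemρ : ∀ (ρ : List (Fin A.clocks)) (j : Fin A.clocks),
      (j : ℕ) ∈ ρ.map Fin.val ↔ j ∈ ρ := fun ρ j => by simp [Fin.val_inj]
  induction i with
  | zero =>
    intro s g a ρ q k ts hts
    have hX : (F (A.code, 0, (s, g, a, ρ.map Fin.val, q), ts, k)).2.2.2 =
        if q ∈ A.goal then notCode falseCode
        else cpreCode (A.ctrl.map Fin.val) q k [] := by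
      rw [hF']
      simp only [AttractorNode.children, if_true, AttractorNode.target, TimedGame.code, hgoal,
        List.map_nil]
    dsimp only
    rw [hX]
    split_ifs with h
    · exact ⟨(IsFormulaCode.false _ _).not, fun l _ _ => by
        simp only [codeSat_notCode, codeSat_falseCode, not_false_eq_true, true_iff]
        exact h⟩
    · refine ⟨IsFormulaCode.cpre _ _ (by simp), fun l hl _ => ?_⟩
      rw [codeSat_cpreCode _ _ hl]
      simpa using! h
  | succ i ih =>
    intro s g a ρ q k ts hts
    -- the records of the transitions of the game
    let T : TimedEdge A.clocks A.locs A.acts → List ℕ := fun e =>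
      delayTerms A.clocks (resetTerms A.clocks ts (ρ.map Fin.val))
        (Nat.pair 1 (k + if e.act ∈ A.ctrl then 0 else 1))
    let R : TimedEdge A.clocks A.locs A.acts → EdgeFormulas := fun e =>
      F (A.code, i, e.code, T e, k + 2)
    have hR : ∀ e, R e = ((e.src : ℕ), (e.act : ℕ), γ (e.guard.code, T e), (R e).2.2.2) :=
      fun e => by simp only [R]; rw [hF']; rfl
    have hT : ∀ e, ∀ j < A.clocks, IsTermCode A.clocks (k + 2) ((T e).getD j 0) := fun e =>
      IsTermCode.delay (IsTermCode.reset hts _) (by split_ifs <;> omega)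
    have hX : (F (A.code, i + 1, (s, g, a, ρ.map Fin.val, q), ts, k)).2.2.2 =
        if q ∈ A.goal then notCode falseCode
        else cpreCode (A.ctrl.map Fin.val) q k (A.edges.map R) := by
      rw [hF']
      simp only [AttractorNode.children, Nat.succ_ne_zero, if_false, AttractorNode.target,
        TimedGame.code, hgoal, List.map_map, Nat.add_sub_cancel]
      congr 2
      refine List.map_congr_left fun e _ => ?_
      simp only [Function.comp, R, T, TimedEdge.code, TimedGame.code, hctrl]
      split_ifs <;> rfl
    dsimp only
    rw [hX]
    split_ifs with h
    · exact ⟨(IsFormulaCode.false _ _).not, fun l _ _ => by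
        simp only [codeSat_notCode, codeSat_falseCode, not_false_eq_true, true_iff]
        exact Or.inl h⟩
    refine ⟨IsFormulaCode.cpre _ _ fun r hr => ?_, fun l hl hl1 => ?_⟩
    · obtain ⟨e, -, rfl⟩ := List.mem_map.1 hr
      refine ⟨?_, (ih e.src e.guard.code e.act e.reset e.tgt _ _ (hT e)).1⟩
      rw [hR]
      exact (hγ' _ _ _ _ (hT e)).1
    · rw [codeSat_cpreCode _ _ hl]
      refine Iff.trans ?_ (⟨Or.inr, fun h' => h'.resolve_left h⟩ :
        _ ∈ A.cpre (A.attractor i) ↔ _)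
      set y : Fin A.clocks → ℝ := fun j => if j ∈ ρ then 0 else
        termVal A.clocks l (ts.getD j 0) with hy
      have hval : ∀ (e : TimedEdge A.clocks A.locs A.acts) (τ σ : ℝ),
          (fun j : Fin A.clocks => termVal A.clocks (l ++ [τ] ++ [σ]) ((T e).getD j 0)) =
            delayed y (if e.act ∈ A.ctrl then τ else σ) := by
        intro e τ σ
        funext j
        have hlen : (l ++ [τ]).length = 1 + A.clocks + (k + 1) := by simp [hl]; omega
        have ht := IsTermCode.reset hts (ρ.map Fin.val) j j.2
        simp only [T]
        rw [delayTerms, getD_map_range j.2, termVal_addCode, ht.succ.termVal_append hlen,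
          ht.termVal_append hl, resetTerms, getD_map_range j.2, delayed]
        congr 1
        · simp only [hmemρ, hy]
          split_ifs
          · exact termVal_zeroCode _ _
          · rfl
        · rw [termVal_bound]
          split_ifs
          · rw [add_zero, ← hl, List.getD_append _ _ _ _ (by simp),
              List.getD_append_right _ _ _ _ le_rfl]
            simp
          · rw [← add_assoc, ← hl, List.getD_append_right _ _ _ _ (by simp)]
            simp
      have hlen : ∀ τ σ : ℝ, (l ++ [τ] ++ [σ]).length = 1 + A.clocks + (k + 2) := fun τ σ => by
        simp [hl]; omega
      have hhead : ∀ τ σ : ℝ, (l ++ [τ] ++ [σ]).getD 0 0 = 1 := fun τ σ => by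
        rw [List.append_assoc, List.getD_append _ _ _ _ (by omega), hl1]
      have hguard : ∀ e τ σ, codeSat A.clocks (R e).2.2.1 (l ++ [τ] ++ [σ]) ↔
          e.guard.Sat (delayed y (if e.act ∈ A.ctrl then τ else σ)) := fun e τ σ => by
        rw [hR, ← hval]
        exact (hγ' _ _ _ _ (hT e)).2 _ (hhead τ σ)
      have htarget : ∀ e τ σ, codeSat A.clocks (R e).2.2.2 (l ++ [τ] ++ [σ]) ↔
          (e.tgt, e.resetAt (delayed y (if e.act ∈ A.ctrl then τ else σ))) ∈
            A.attractor i := fun e τ σ => by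
        rw [← hval]
        exact (ih e.src e.guard.code e.act e.reset e.tgt _ _ (hT e)).2 _ (hlen τ σ)
          (hhead τ σ)
      have hsrc : ∀ e, (R e).1 = q ↔ e.src = q := fun e => by
        rw [hR, Fin.val_inj]
      have hact : ∀ e e', (R e).2.1 = (R e').2.1 ↔ e.act = e'.act := fun e e' => by
        rw [hR, hR e', Fin.val_inj]
      have hctrl' : ∀ e, (R e).2.1 ∈ A.ctrl.map Fin.val ↔ e.act ∈ A.ctrl := fun e => by
        rw [hR, hctrl]
      have hex : ∀ P : EdgeFormulas → Prop,
          (∃ r ∈ A.edges.map R, P r) ↔ ∃ e ∈ A.edges, P (R e) := fun P => by simp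
      simp only [hex, List.forall_mem_map, hsrc, hact, hctrl', hguard, htarget]
      constructor
      · rintro ⟨τ, hτ⟩
        refine ⟨τ, (hτ 0).1, ?_, fun σ hσ hστ e he h1 h2 h3 => ?_⟩
        · obtain ⟨-, ⟨e₀, he₀, h1, h2, h3, h4⟩, -⟩ := hτ 0
          rw [if_pos h2] at h3
          refine ⟨e₀, he₀, h1, h2, h3, fun e he h5 h6 h7 => ?_⟩
          have := h4 e he h5 h6
          rw [if_pos (h6 ▸ h2)] at this
          exact this h7
        · have := (hτ σ).2.2 hσ hστ e he h1 h2
          rw [if_neg h2] at this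
          exact this h3
      · rintro ⟨τ, hτ, ⟨e₀, he₀, h1, h2, h3, h4⟩, h5⟩
        refine ⟨τ, fun σ => ⟨hτ, ⟨e₀, he₀, h1, h2, ?_, fun e he h6 h7 => ?_⟩,
          fun hσ hστ e he h6 h7 => ?_⟩⟩
        · rw [if_pos h2]
          exact h3
        · rw [if_pos (h7 ▸ h2)]
          exact h4 e he h6 h7
        · rw [if_neg h7]
          exact h5 σ hσ hστ e he h6 h7

/-! ### A computable bound for the number of regions -/

theorem ClockConstraint.bounded_of_code_le {n M : ℕ} {g : ClockConstraint n} (h : g.code ≤ M) :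
    g.Bounded M.factorial (M * M.factorial) := by
  have key : ∀ c : ℚ≥0, Nat.pair c.num c.den ≤ M →
      ∃ k : ℕ, k ≤ M * M.factorial ∧ (c : ℝ) = k / M.factorial := by
    intro c hc
    have hnum : c.num ≤ M := (Nat.left_le_pair _ _).trans hc
    obtain ⟨d, hd⟩ := Nat.dvd_factorial c.den_pos ((Nat.right_le_pair _ _).trans hc)
    refine ⟨c.num * d, Nat.mul_le_mul hnum (hd ▸ Nat.le_mul_of_pos_left _ c.den_pos), ?_⟩
    have h1 : (0 : ℝ) < M.factorial := by exact_mod_cast Nat.factorial_pos M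
    have h2 : (0 : ℝ) < c.den := by exact_mod_cast c.den_pos
    have hq : (c : ℝ) = (c.num : ℝ) / (c.den : ℝ) := by
      conv_lhs => rw [← NNRat.num_div_den c]
      push_cast
      rfl
    rw [hq, div_eq_div_iff h2.ne' h1.ne', hd]
    push_cast
    ring
  induction g with
  | le i c =>
    exact key c ((Nat.right_le_pair _ _).trans ((Nat.right_le_pair _ _).trans h))
  | ge i c =>
    exact key c ((Nat.right_le_pair _ _).trans ((Nat.right_le_pair _ _).trans h))
  | not g ih => exact ih ((Nat.right_le_pair _ _).trans h)
  | and g₁ g₂ ih₁ ih₂ =>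
    have h' := (Nat.right_le_pair _ _).trans h
    exact ⟨ih₁ ((Nat.left_le_pair _ _).trans h'), ih₂ ((Nat.right_le_pair _ _).trans h')⟩

theorem encode_le_encode_list {α : Type} [Encodable α] {a : α} {L : List α} (h : a ∈ L) :
    Encodable.encode a ≤ Encodable.encode L := by
  induction L with
  | nil => simp at h
  | cons b L ih =>
    rw [Encodable.encode_list_cons]
    rcases List.mem_cons.1 h with rfl | h
    · exact (Nat.left_le_pair _ _).trans (Nat.le_succ _)
    · exact (ih h).trans ((Nat.right_le_pair _ _).trans (Nat.le_succ _))

theorem encode_fst_le {α β : Type} [Encodable α] [Encodable β] (p : α × β) :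
    Encodable.encode p.1 ≤ Encodable.encode p := by
  rw [Encodable.encode_prod_val p.1 p.2]
  exact Nat.left_le_pair _ _

theorem encode_snd_le {α β : Type} [Encodable α] [Encodable β] (p : α × β) :
    Encodable.encode p.2 ≤ Encodable.encode p := by
  rw [Encodable.encode_prod_val p.1 p.2]
  exact Nat.right_le_pair _ _

/-- A number of moves within which a controller that can force a visit to a goal location of
the timed game with the code `G` can do so. It is generous: the code of the game bounds its numbers
of clocks and locations, and all numerators and denominators in its guards. -/
def moveBound (G : TimedGameCode) : ℕ :=
  regionCount (Encodable.encode G) (Encodable.encode G)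
    (Encodable.encode G * (Encodable.encode G).factorial)

theorem primrec_moveBound : Primrec moveBound := by
  have hM : Primrec fun G : TimedGameCode => Encodable.encode G := Primrec.encode
  have hM' := Primrec.succ.comp hM
  exact Primrec.nat_mul.comp hM (primrec_pow (.const 2) (Primrec.nat_mul.comp hM'
    (Primrec.nat_mul.comp hM' (Primrec.succ.comp (Primrec.nat_mul.comp (.const 2)
      (Primrec.nat_mul.comp hM (primrec_factorial.comp hM)))))))

theorem regionCount_mono {n n' m m' K : ℕ} (hn : n ≤ n') (hm : m ≤ m') :
    regionCount n m K ≤ regionCount n' m' K := by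
  unfold regionCount
  gcongr
  norm_num

/-- The winning states are the states from which a visit to a goal location can be forced within
the computable number `moveBound` of moves. -/
theorem TimedGame.mem_winningStates_iff (A : TimedGame) (q : Fin A.locs)
    (y : Fin A.clocks → ℝ) :
    (q, y) ∈ A.toHybrid.winningStates ↔
      y ∈ clockValuations A.clocks ∧ (q, y) ∈ A.attractor (moveBound A.code) := by
  have h1 := encode_snd_le A.code
  have h2 := encode_snd_le A.code.2
  have h3 := encode_snd_le A.code.2.2
  have h4 := encode_snd_le A.code.2.2.2
  have h5 := encode_snd_le A.code.2.2.2.2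
  have hbounded : A.Bounded (Encodable.encode A.code).factorial
      (Encodable.encode A.code * (Encodable.encode A.code).factorial) := by
    intro e he
    refine ClockConstraint.bounded_of_code_le ?_
    have h6 : Encodable.encode e.code ≤ Encodable.encode A.code.2.2.2.2.2 :=
      encode_le_encode_list (List.mem_map_of_mem he)
    have h7 := encode_snd_le e.code
    have h8 := encode_fst_le e.code.2
    have h9 : Encodable.encode e.code.2.1 = e.guard.code := Encodable.encode_nat _
    omega
  refine hbounded.mem_winningStates_iff (Nat.factorial_pos _) (regionCount_mono ?_ ?_) q y
  · exact (Encodable.encode_nat _).ge.trans (encode_fst_le A.code)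
  · exact ((Encodable.encode_nat _).ge.trans (encode_fst_le A.code.2)).trans h1

/-! ### Computing the winning states and deciding the control problem -/

theorem realEnv_length {n : ℕ} (v : Fin n → ℝ) (z : Fin 0 → ℝ) :
    (realEnv v z).length = 1 + n + 0 := by
  simp [realEnv, add_comm]

theorem formula_realize_iff_codeSat {n : ℕ} (φ : linLang.Formula (Fin n)) (v : Fin n → ℝ)
    (z : Fin 0 → ℝ) : φ.Realize v ↔ codeSat n (formulaCode φ) (realEnv v z) := by
  rw [← realize_iff_codeSat, FirstOrder.Language.Formula.Realize]
  exact iff_of_eq (congrArg _ (Subsingleton.elim _ _))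

/-- Formulas that define the sets of winning states are computed by a primitive recursive
function. -/
theorem exists_primrec_winningFormula :
    ∃ F : TimedGameCode × ℕ → ℕ, Primrec F ∧ ∀ (A : TimedGame) (q : Fin A.locs),
      ∃ φ : linLang.Formula (Fin A.clocks), F (A.code, (q : ℕ)) = formulaCode φ ∧
        ∀ v : Fin A.clocks → ℝ, φ.Realize v ↔ (q, v) ∈ A.toHybrid.winningStates := by
  obtain ⟨f, hf, hf'⟩ := exists_primrec_attractorFormula
  have hG : Primrec fun p : TimedGameCode × ℕ => p.1 := Primrec.fst
  have hrange : Primrec fun p : TimedGameCode × ℕ => List.range p.1.1 :=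
    Primrec.list_range.comp (Primrec.fst.comp hG)
  have hvar : Primrec₂ fun (_ : TimedGameCode × ℕ) (j : ℕ) => Nat.pair 0 j :=
    (primrec_pairConst 0 Primrec.snd).to₂
  refine ⟨fun p => andCode
    (conjCode ((List.range p.1.1).map fun j => notCode (ltCode (Nat.pair 0 j) zeroCode)))
    (f (p.1, moveBound p.1, (0, 0, 0, [], p.2),
      (List.range p.1.1).map fun j => Nat.pair 0 j, 0)), ?_, fun A q => ?_⟩
  · exact primrec_andCode
      (primrec_conjCode (Primrec.list_map hrange (primrec_notCode
        (primrec_ltCode (primrec_pairConst 0 Primrec.snd) (.const _))).to₂))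
      (hf.comp (hG.pair ((primrec_moveBound.comp hG).pair
        (((Primrec.const 0).pair ((Primrec.const 0).pair ((Primrec.const 0).pair
          ((Primrec.const []).pair Primrec.snd)))).pair
          ((Primrec.list_map hrange hvar).pair (.const 0))))))
  · have hts : ∀ j < A.clocks, ((List.range A.clocks).map fun j => Nat.pair 0 j).getD j 0 =
        Nat.pair 0 j := fun j hj => getD_map_range hj _
    obtain ⟨h1, h2⟩ := hf' A (moveBound A.code) 0 0 0 [] q 0
      ((List.range A.clocks).map fun j => Nat.pair 0 j)
      (fun j hj => by rw [hts j hj]; exact .free 0 hj)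
    have hnonneg : IsFormulaCode A.clocks 0 (conjCode ((List.range A.clocks).map fun j =>
        notCode (ltCode (Nat.pair 0 j) zeroCode))) := .conj fun c hc => by
      obtain ⟨j, hj, rfl⟩ := List.mem_map.1 hc
      exact (IsFormulaCode.lt (.free 0 (List.mem_range.1 hj)) (.zero _ _)).not
    obtain ⟨φ, hφ⟩ := hnonneg.and h1
    refine ⟨φ, hφ.symm, fun v => ?_⟩
    have hval : ∀ (z : Fin 0 → ℝ) (j : Fin A.clocks),
        termVal A.clocks (realEnv v z) (Nat.pair 0 j) = v j := fun z j => by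
      rw [termVal_free, realEnv_getD_free]
    rw [formula_realize_iff_codeSat φ v default, hφ, codeSat_andCode,
      h2 _ (realEnv_length v _) rfl, A.mem_winningStates_iff, codeSat_conjCode,
      List.forall_mem_map]
    refine and_congr ⟨fun h j => ?_, fun h j hj => ?_⟩ ?_
    · have := h j (List.mem_range.2 j.2)
      rwa [codeSat_notCode, codeSat_ltCode, hval, termVal_zeroCode, not_lt] at this
    · have := h ⟨j, List.mem_range.1 hj⟩
      rwa [codeSat_notCode, codeSat_ltCode, hval _ ⟨j, List.mem_range.1 hj⟩, termVal_zeroCode,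
        not_lt]
    · simp only [List.not_mem_nil, if_false, hts _ (Fin.is_lt _), hval]

/-- Quantifiers in front of a formula capture its free variables as well: in an environment without
entries for them, the quantified values take their places. -/
theorem codeSat_iterate_allCode (n m c : ℕ) (l : List ℝ) :
    codeSat n (allCode^[m] c) l ↔ ∀ v : Fin m → ℝ, codeSat n c (l ++ List.ofFn v) := by
  induction m generalizing l with
  | zero => simp
  | succ m ih =>
    rw [Function.iterate_succ_apply', codeSat_allCode]
    simp only [ih]
    constructor
    · intro h v
      have := h (v 0) (fun i => v i.succ)
      rwa [List.append_assoc, List.singleton_append, ← List.ofFn_succ] at this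
    · intro h x v
      have := h (Fin.cons x v)
      rw [List.ofFn_succ] at this
      simpa using this
theorem mainTheorem11 :
    -- the control problem is decidable: input a timed game, a location, and a formula that
    -- defines a clock valuation
    (∃ f : TimedGameCode × ℕ × ℕ → Bool, Computable f ∧
      ∀ (A : TimedGame) (q : Fin A.locs) (y : Fin A.clocks → ℝ)
        (φ : linLang.Formula (Fin A.clocks)),
        y ∈ clockValuations A.clocks →
        (∀ v : Fin A.clocks → ℝ, φ.Realize v ↔ v = y) →
        (f (A.code, (q : ℕ), formulaCode φ) = true ↔ (q, y) ∈ A.toHybrid.winningStates)) ∧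
    -- the set of winning states is computable: for each location a defining formula is computed
    (∃ F : TimedGameCode × ℕ → ℕ, Computable F ∧
      ∀ (A : TimedGame) (q : Fin A.locs),
        ∃ φ : linLang.Formula (Fin A.clocks),
          F (A.code, (q : ℕ)) = formulaCode φ ∧
          ∀ v : Fin A.clocks → ℝ, φ.Realize v ↔ (q, v) ∈ A.toHybrid.winningStates) := by
  obtain ⟨F, hF, hF'⟩ := exists_primrec_winningFormula
  obtain ⟨E, hE, hE'⟩ := exists_primrec_codeSat
  refine ⟨⟨fun p => E (p.1.1, allCode^[p.1.1] (impCode p.2.2 (F (p.1, p.2.1))), [(1, 0)]),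
    Primrec.to_comp ?_, fun A q y φ _ hφ => ?_⟩, F, hF.to_comp, hF'⟩
  · have hn : Primrec fun p : TimedGameCode × ℕ × ℕ => p.1.1 := Primrec.fst.comp Primrec.fst
    have hq : Primrec fun p : TimedGameCode × ℕ × ℕ => p.2.1 := Primrec.fst.comp Primrec.snd
    have hφ : Primrec fun p : TimedGameCode × ℕ × ℕ => p.2.2 := Primrec.snd.comp Primrec.snd
    exact hE.comp (hn.pair ((Primrec.nat_iterate hn
      (primrec_impCode hφ (hF.comp (Primrec.fst.pair hq)))
      (primrec_allCode Primrec.snd).to₂).pair (.const _)))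
  · obtain ⟨ψ, hψ, hψ'⟩ := hF' A q
    -- the sentence `∀ v, φ(v) → ψ(v)`, whose free variables are captured as the first entries
    -- of the environment, expresses that the point defined by `φ` is winning
    have henv : ∀ v : Fin A.clocks → ℝ,
        diffEnv [(1, 0)] ++ List.ofFn v = realEnv v (default : Fin 0 → ℝ) := fun v => by
      simp [diffEnv, diffHom_apply, realEnv]
    have himp : ∀ v : Fin A.clocks → ℝ,
        codeSat A.clocks (impCode (formulaCode φ) (F (A.code, (q : ℕ))))
          (diffEnv [(1, 0)] ++ List.ofFn v) ↔
        (φ.Realize v → (q, v) ∈ A.toHybrid.winningStates) := fun v => by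
      rw [henv, codeSat_impCode, hψ, ← formula_realize_iff_codeSat,
        ← formula_realize_iff_codeSat, hψ']
    refine ((hE' _ _ _).trans (codeSat_iterate_allCode _ _ _ _)).trans
      ((forall_congr' himp).trans ?_)
    simp only [hφ, forall_eq]
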